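/- **Theorem (Circuit index).** Let $\mathcal I=[t_0,t_{\mathrm{end}}]$ with $t_0<t_{\mathrm{end}}$. All given functions are assumed smooth ($C^\infty$), and a real square matrix $T$, not necessarily symmetric, is called positive definite if $u^\top T u>0$ for all $u\neq 0$. *Differential index.* For a system $\mathbf F(\mathbf x',\mathbf x,t)=0$ write $\frac{d^j}{dt^j}\mathbf F$ for the formal time derivatives, functions of $\mathbf x,\mathbf x',\dots,\mathbf x^{(j+1)},t$ given by the chain rule. An equation $R(\mathbf x,\mathbf x',\dots,\mathbf x^{(m+1)},t)=0$ is *obtained from $\mathbf F=0$ with $m$ differentiations and algebraic manipulations* if $R=\sum_{j=0}^m M_j\,\frac{d^j}{dt^j}\mathbf F$ identically (for all values of the variables and all $t\in\mathcal I$), with matrix coefficients $M_j$ that are functions of $\mathbf x,\dots,\mathbf x^{(m+1)},t$. The system has *differential index* $m$ if $m\ge 0$ is minimal such that, for some continuous $\Phi$, the equation $\mathbf x'-\Phi(\mathbf x,t)=0$ is obtained in this way with $m$ differentiations and continuous coefficients. *Inductance-like element.* Such an element, with internal variables $\mathbf x_\lambda\in\mathbb R^{n_{\mathrm{dof}}}$,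 currents $\mathbf i_\lambda\in\mathbb R^{n_\lambda}$ and voltages $\mathbf v_\lambda\in\mathbb R^{n_\lambda}$, is given by $n_{\mathrm{dof}}+n_\lambda$ equations $\mathbf F_\lambda(\mathbf x_\lambda',\mathbf i_\lambda',\mathbf x_\lambda,\mathbf i_\lambda,\mathbf v_\lambda,t)=0$ for which there are smooth functions $\phi,\mathbf f_{\mathbf x},\mathbf f_\phi$ such that the equations $$\mathbf x_\lambda'=\mathbf f_{\mathbf x}(\mathbf x_\lambda,\mathbf i_\lambda,\mathbf v_\lambda,t),\qquad \tfrac{d}{dt}\phi(\mathbf i_\lambda,\mathbf x_\lambda,t)=\mathbf f_\phi(\mathbf x_\lambda,\mathbf i_\lambda,\mathbf v_\lambda,t)$$ are obtained from $\mathbf F_\lambda=0$ with at most one differentiation and algebraic manipulations with smooth coefficients, and such that, for all values of the arguments and $t\in\mathcal I$, $\partial\phi/\partial\mathbf i_\lambda$ is regular and $$\frac{\partial}{\partial\mathbf v_\lambda}\Big(\big(\tfrac{\partial\phi}{\partial\mathbf i_\lambda}\big)^{-1}\big(-\tfrac{\partial\phi}{\partial\mathbf x_\lambda}\mathbf f_{\mathbf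 x}-\tfrac{\partial\phi}{\partial t}+\mathbf f_\phi\big)\Big)$$ is positive definite. *Circuit.* Consider a circuit, modelled as a finite directed graph with a ground node, whose branches hold capacitors ($\mathrm C$), resistors ($\mathrm R$), inductors ($\mathrm L$), voltage sources ($\mathrm V$), current sources ($\mathrm I$) and the branches ($\lambda$) of an inductance-like element. Let $\mathbf A_\star$ be the columns of its reduced incidence matrix (ground row deleted) that belong to the branches of type $\star$. Assume well-posedness: * there are no cutsets of current sources only, i.e. $\ker(\mathbf A_R\ \mathbf A_C\ \mathbf A_V\ \mathbf A_L\ \mathbf A_\lambda)^\top=\{0\}$; * there are no loops of voltage sources only, i.e. $\ker\mathbf A_V=\{0\}$; * $\partial\mathbf g(\mathbf v_R,t)/\partial\mathbf v_R$, $\partial\phi_L(\mathbf i_L,t)/\partial\mathbf i_L$ and $\partial\mathbf q(\mathbf v_C,t)/\partial\mathbf v_C$ are positive definite for all arguments and all $t\in\mathcal I$. Consider the coupled system for $(\mathbf e,\mathbf i_L,\mathbf i_V,\mathbf x_\lambda,\mathbf i_\lambda)$ $$\begin{aligned} \mathbf A_C\tfrac{d}{dt}\mathbf q(\mathbf A_C^\top\mathbf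 e,t)+\mathbf A_R\mathbf g(\mathbf A_R^\top\mathbf e,t)+\mathbf A_L\mathbf i_L+\mathbf A_V\mathbf i_V+\mathbf A_\lambda\mathbf i_\lambda+\mathbf A_I\mathbf i_{\mathrm{src}}(t)&=0,\\ \tfrac{d}{dt}\phi_L(\mathbf i_L,t)-\mathbf A_L^\top\mathbf e&=0,\\ \mathbf A_V^\top\mathbf e-\mathbf v_{\mathrm{src}}(t)&=0,\\ \mathbf F_\lambda(\mathbf x_\lambda',\mathbf i_\lambda',\mathbf x_\lambda,\mathbf i_\lambda,\mathbf A_\lambda^\top\mathbf e,t)&=0 . \end{aligned}$$ Assume that it is a DAE, i.e. that the determinant of its Jacobian with respect to the time derivatives of the unknowns vanishes (for all arguments with $t\in\mathcal I$), and that the system and its first time derivative are not contradictory, i.e. that they hold simultaneously for at least one $t\in\mathcal I$ and one choice of values of the unknowns and their first two derivatives (as is the case if there is a $C^2$ solution on $\mathcal I$). Let $\mathbf Q_C$ be any projector onto $\ker\mathbf A_C^\top$. Then the coupled system has differential index 1. $1$, if there are no cutsets of inductors, current sources and inductance-like elements only (LI$\lambda$-cutsets), i.e. $\ker(\mathbf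 A_R\ \mathbf A_C\ \mathbf A_V)^\top=\{0\}$, and no CV-loops, i.e. $\ker\mathbf Q_C^\top\mathbf A_V=\{0\}$; 2. $2$, otherwise. -/

import Mathlib

open scoped ContDiff Matrix

/-! ### Differential-algebraic equations and the differential index -/

/-- Jets of order `k` of curves in `X`: the values `x, x', …, x⁽ᵏ⁾` (the `j`-th entry is the `j`-th
derivative), together with the time `t`. -/
abbrev Jet (k : ℕ) (X : Type*) := (Fin (k + 1) → X) × ℝ

namespace Jet

variable {X : Type*}

/-- Forget the derivatives of order larger than `k`. -/
def trunc {k m : ℕ} (h : k ≤ m) (p : Jet m X) : Jet k X :=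
  (fun i => p.1 (Fin.castLE (Nat.succ_le_succ h) i), p.2)

end Jet

/-- The total time derivative `d/dt G(x, x', …, x⁽ᵏ⁾, t)`, as a function of
`x, x', …, x⁽ᵏ⁺¹⁾, t`, given by the chain rule. -/
noncomputable def totalDeriv {X W : Type*} [NormedAddCommGroup X] [NormedSpace ℝ X]
    [NormedAddCommGroup W] [NormedSpace ℝ W] {k : ℕ} (G : Jet k X → W) : Jet (k + 1) X → W :=
  fun p => fderiv ℝ G (p.trunc (Nat.le_succ k)) (fun i => p.1 i.succ, 1)

/-- A DAE is `F (x', x, t) = 0`; `derivArray F j` is `dʲ/dtʲ F (x', x, t)`, as a function of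
`x, x', …, x⁽ʲ⁺¹⁾, t`. -/
noncomputable def derivArray {X W : Type*} [NormedAddCommGroup X] [NormedSpace ℝ X]
    [NormedAddCommGroup W] [NormedSpace ℝ W] (F : X × X × ℝ → W) : (j : ℕ) → Jet (j + 1) X → W
  | 0 => fun p => F (p.1 1, p.1 0, p.2)
  | j + 1 => totalDeriv (derivArray F j)

/-- The equation `R (x, x', …, x⁽ᵐ⁺¹⁾, t) = 0` is obtained, for times in `I`, by algebraic
manipulations from the DAE `F = 0` and its first `m` time derivatives: `R` is a combination of
`F, dF/dt, …, dᵐF/dtᵐ` whose coefficients are `C^r` functions of the variables that occur. -/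
def ObtainedFrom {X W U : Type*} [NormedAddCommGroup X] [NormedSpace ℝ X]
    [NormedAddCommGroup W] [NormedSpace ℝ W] [NormedAddCommGroup U] [NormedSpace ℝ U]
    (r : WithTop ℕ∞) (F : X × X × ℝ → W) (I : Set ℝ) (m : ℕ) (R : Jet (m + 1) X → U) : Prop :=
  ∃ M : Fin (m + 1) → Jet (m + 1) X → (W →L[ℝ] U),
    (∀ j, ContDiffOn ℝ r (M j) {p | p.2 ∈ I}) ∧
    ∀ p : Jet (m + 1) X, p.2 ∈ I →
      R p = ∑ j : Fin (m + 1), M j p (derivArray F j (p.trunc (Nat.succ_le_succ j.is_le)))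

/-- With `m` differentiations and algebraic manipulations one can write the DAE `F = 0` as an
ordinary differential equation `x' = Φ (x, t)` with `Φ` continuous. -/
def ReducibleToODE {X W : Type*} [NormedAddCommGroup X] [NormedSpace ℝ X]
    [NormedAddCommGroup W] [NormedSpace ℝ W] (F : X × X × ℝ → W) (I : Set ℝ) (m : ℕ) : Prop :=
  ∃ Φ : X × ℝ → X, ContinuousOn Φ {p | p.2 ∈ I} ∧
    ObtainedFrom 0 F I m (fun p : Jet (m + 1) X => p.1 1 - Φ (p.1 0, p.2))

/-- The DAE `F = 0` has differential index `m`: `m` is the minimal number of differentiations with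
which it can be written as an ordinary differential equation. -/
def HasDifferentialIndex {X W : Type*} [NormedAddCommGroup X] [NormedSpace ℝ X]
    [NormedAddCommGroup W] [NormedSpace ℝ W] (F : X × X × ℝ → W) (I : Set ℝ) (m : ℕ) : Prop :=
  ReducibleToODE F I m ∧ ∀ k < m, ¬ ReducibleToODE F I k

/-- `det (∂F/∂x') = 0`: the system `F = 0` is differential-algebraic. -/
def IsDAE {X : Type*} [NormedAddCommGroup X] [NormedSpace ℝ X] (F : X × X × ℝ → X)
    (I : Set ℝ) : Prop :=
  ∀ x₁ x : X, ∀ t ∈ I, (fderiv ℝ (fun y => F (y, x, t)) x₁).det = 0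

/-- The equations `F = 0, …, dᵐF/dtᵐ = 0` are not contradictory: they hold for at least one time
`t` in `I` and one choice of values for `x, x', …, x⁽ᵐ⁺¹⁾`. -/
def IsConsistent {X W : Type*} [NormedAddCommGroup X] [NormedSpace ℝ X]
    [NormedAddCommGroup W] [NormedSpace ℝ W] (F : X × X × ℝ → W) (I : Set ℝ) (m : ℕ) : Prop :=
  ∃ p : Jet (m + 1) X, p.2 ∈ I ∧
    ∀ j : Fin (m + 1), derivArray F j (p.trunc (Nat.succ_le_succ j.is_le)) = 0

/-- Positive definiteness `uᵀ T u > 0` for `u ≠ 0` (symmetry is not required). -/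
def IsPosDef {ι : Type*} [Fintype ι] (T : (ι → ℝ) →L[ℝ] (ι → ℝ)) : Prop :=
  ∀ u : ι → ℝ, u ≠ 0 → 0 < u ⬝ᵥ T u

/-! ### Inductance-like elements -/

section Element

variable {D Λ : Type*} [Fintype D] [Fintype Λ]

/-- The element equations `F (x', i', x, i, v, t) = 0` as a DAE for `((x, i), v)`. -/
def elementDAE (F : (D → ℝ) × (Λ → ℝ) × (D → ℝ) × (Λ → ℝ) × (Λ → ℝ) × ℝ → (D → ℝ) × (Λ → ℝ)) :
    (((D → ℝ) × (Λ → ℝ)) × (Λ → ℝ)) × (((D → ℝ) × (Λ → ℝ)) × (Λ → ℝ)) × ℝ →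
      (D → ℝ) × (Λ → ℝ) :=
  fun p => F (p.1.1.1, p.1.1.2, p.2.1.1.1, p.2.1.1.2, p.2.1.2, p.2.2)

/-- An inductance-like element on the time set `I`, with internal variables `x : I → ℝ^D`, currents
`i` and voltages `v : I → ℝ^Λ`, described by the DAE `F (x', i', x, i, v, t) = 0`. -/
def IsInductanceLike (I : Set ℝ)
    (F : (D → ℝ) × (Λ → ℝ) × (D → ℝ) × (Λ → ℝ) × (Λ → ℝ) × ℝ → (D → ℝ) × (Λ → ℝ)) : Prop :=
  ContDiff ℝ ∞ F ∧
  ∃ (φ : (Λ → ℝ) × (D → ℝ) × ℝ → (Λ → ℝ))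
    (fx : (D → ℝ) × (Λ → ℝ) × (Λ → ℝ) × ℝ → (D → ℝ))
    (fφ : (D → ℝ) × (Λ → ℝ) × (Λ → ℝ) × ℝ → (Λ → ℝ)),
    ContDiff ℝ ∞ φ ∧ ContDiff ℝ ∞ fx ∧ ContDiff ℝ ∞ fφ ∧
    -- the equation `x' = fx (x, i, v, t)`
    ObtainedFrom ∞ (elementDAE F) I 1
      (fun p : Jet 2 (((D → ℝ) × (Λ → ℝ)) × (Λ → ℝ)) =>
        (p.1 1).1.1 - fx ((p.1 0).1.1, (p.1 0).1.2, (p.1 0).2, p.2)) ∧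
    -- the equation `d/dt φ (i, x, t) = fφ (x, i, v, t)`
    ObtainedFrom ∞ (elementDAE F) I 1
      (fun p : Jet 2 (((D → ℝ) × (Λ → ℝ)) × (Λ → ℝ)) =>
        totalDeriv (fun q : Jet 0 (((D → ℝ) × (Λ → ℝ)) × (Λ → ℝ)) =>
            φ ((q.1 0).1.2, (q.1 0).1.1, q.2)) (p.trunc one_le_two)
          - fφ ((p.1 0).1.1, (p.1 0).1.2, (p.1 0).2, p.2)) ∧
    -- `∂φ/∂i` is regular
    (∀ i x, ∀ t ∈ I, (fderiv ℝ (fun i' => φ (i', x, t)) i).IsInvertible) ∧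
    -- `∂/∂v ((∂φ/∂i)⁻¹ (- ∂φ/∂x fx - ∂φ/∂t + fφ))` is positive definite
    (∀ x i v, ∀ t ∈ I, IsPosDef (fderiv ℝ (fun v' : Λ → ℝ =>
      (fderiv ℝ (fun i' => φ (i', x, t)) i).inverse
        (-(fderiv ℝ (fun x' => φ (i, x', t)) x (fx (x, i, v', t)))
          - deriv (fun s => φ (i, x, s)) t + fφ (x, i, v', t))) v))

end Element

/-! ### Circuits -/

open Classical in
/-- The reduced incidence matrix of a directed graph: nodes are the elements of `N` and the ground
node `none`; the branch `b` leaves the node `(ends b).1` and enters `(ends b).2`. -/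
noncomputable def incidence {N B : Type*} (ends : B → Option N × Option N) : Matrix N B ℝ :=
  fun n b => (if (ends b).1 = some n then 1 else 0) - (if (ends b).2 = some n then 1 else 0)

/-- A circuit: a directed graph on `N` and the ground node, with branches `C`, `R`, `L`, `V`, `J`
and `Λ` holding capacitors, resistors, inductors, voltage sources, current sources and generalised
elements, together with the functions of the lumped models. -/
structure Circuit (N C R L V J Λ : Type*) where
  endsC : C → Option N × Option N
  endsR : R → Option N × Option N
  endsL : L → Option N × Option N
  endsV : V → Option N × Option N
  endsI : J → Option N × Option N
  endsΛ : Λ → Option N × Option N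
  /-- charges `q (v_C, t)` -/
  q : (C → ℝ) × ℝ → (C → ℝ)
  /-- resistor currents `g (v_R, t)` -/
  g : (R → ℝ) × ℝ → (R → ℝ)
  /-- fluxes `φ_L (i_L, t)` -/
  φL : (L → ℝ) × ℝ → (L → ℝ)
  isrc : ℝ → (J → ℝ)
  vsrc : ℝ → (V → ℝ)

namespace Circuit

variable {N C R L V J Λ D : Type*} (S : Circuit N C R L V J Λ)

noncomputable def AC : Matrix N C ℝ := incidence S.endsC
noncomputable def AR : Matrix N R ℝ := incidence S.endsR
noncomputable def AL : Matrix N L ℝ := incidence S.endsL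
noncomputable def AV : Matrix N V ℝ := incidence S.endsV
noncomputable def AI : Matrix N J ℝ := incidence S.endsI
noncomputable def AΛ : Matrix N Λ ℝ := incidence S.endsΛ

variable [Fintype N] [Fintype C] [Fintype R] [Fintype L] [Fintype V] [Fintype J] [Fintype Λ]
  [Fintype D]

/-- All functions of the lumped models are smooth. -/
structure IsSmooth : Prop where
  q : ContDiff ℝ ∞ S.q
  g : ContDiff ℝ ∞ S.g
  φL : ContDiff ℝ ∞ S.φL
  isrc : ContDiff ℝ ∞ S.isrc
  vsrc : ContDiff ℝ ∞ S.vsrc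

/-- Well-posedness of the circuit on the time set `I`. -/
structure WellPosed (I : Set ℝ) : Prop where
  /-- no cutsets of current sources only: `ker (A_R A_C A_V A_L A_λ)ᵀ = {0}` -/
  noICutset : LinearMap.ker (Matrix.fromCols S.AR (Matrix.fromCols S.AC
    (Matrix.fromCols S.AV (Matrix.fromCols S.AL S.AΛ))))ᵀ.mulVecLin = ⊥
  /-- no loops of voltage sources only: `ker A_V = {0}` -/
  noVLoop : LinearMap.ker S.AV.mulVecLin = ⊥
  posDefG : ∀ v, ∀ t ∈ I, IsPosDef (fderiv ℝ (fun v' => S.g (v', t)) v)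
  posDefL : ∀ i, ∀ t ∈ I, IsPosDef (fderiv ℝ (fun i' => S.φL (i', t)) i)
  posDefC : ∀ v, ∀ t ∈ I, IsPosDef (fderiv ℝ (fun v' => S.q (v', t)) v)

/-- No cutsets of inductors, current sources and generalised elements only:
`ker (A_R A_C A_V)ᵀ = {0}`. -/
def NoLIΛCutset : Prop :=
  LinearMap.ker (Matrix.fromCols S.AR (Matrix.fromCols S.AC S.AV))ᵀ.mulVecLin = ⊥

/-- `Q` is a projector onto `ker A_Cᵀ`. -/
def IsProjectorQC (Q : Matrix N N ℝ) : Prop :=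
  Q * Q = Q ∧ LinearMap.range Q.mulVecLin = LinearMap.ker S.ACᵀ.mulVecLin

/-- No loops of voltage sources and capacitors, expressed through a projector `Q` onto `ker A_Cᵀ`:
`ker Qᵀ A_V = {0}`. -/
def NoCVLoop (Q : Matrix N N ℝ) : Prop :=
  LinearMap.ker (Qᵀ * S.AV).mulVecLin = ⊥

/-- The coupled system of the circuit and a generalised element with equations
`F (x', i', x, i, v, t) = 0` and `v = A_λᵀ e`, as a DAE for the node potentials `e`, the currents
`i_L` and `i_V`, and the variables `(x, i)` of the element. -/
noncomputable def coupledDAE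
    (F : (D → ℝ) × (Λ → ℝ) × (D → ℝ) × (Λ → ℝ) × (Λ → ℝ) × ℝ → (D → ℝ) × (Λ → ℝ)) :
    ((N → ℝ) × (L → ℝ) × (V → ℝ) × (D → ℝ) × (Λ → ℝ)) ×
      ((N → ℝ) × (L → ℝ) × (V → ℝ) × (D → ℝ) × (Λ → ℝ)) × ℝ →
      (N → ℝ) × (L → ℝ) × (V → ℝ) × (D → ℝ) × (Λ → ℝ) :=
  fun ⟨⟨e', iL', _, x', i'⟩, ⟨e, iL, iV, x, i⟩, t⟩ =>
    (S.AC *ᵥ (fderiv ℝ S.q (S.ACᵀ *ᵥ e, t) (S.ACᵀ *ᵥ e', 1)) + S.AR *ᵥ S.g (S.ARᵀ *ᵥ e, t)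
        + S.AL *ᵥ iL + S.AV *ᵥ iV + S.AΛ *ᵥ i + S.AI *ᵥ S.isrc t,
      fderiv ℝ S.φL (iL, t) (iL', 1) - S.ALᵀ *ᵥ e,
      S.AVᵀ *ᵥ e - S.vsrc t,
      F (x', i', x, i, S.AΛᵀ *ᵥ e, t))

end Circuit

/-!
Kirchhoff's laws and the element equations are differentiated and combined symbolically: the
equations obtained from `F = 0` with `m` differentiations form a class that is closed under linear
combinations with smooth coefficients, and, at the price of one more differentiation, under total
derivatives (`ObtainedFrom.totalDeriv`). An equation `A (x, t) x' = b (x, t)` in this class with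
`A` injective can be solved for `x'`, since injective linear maps have a smoothly varying left
inverse `(AᵀA)⁻¹Aᵀ` (`ObtainedQuasilinear.reducibleToODE`).

One differentiation yields Kirchhoff's current law, the differentiated voltage constraints, the
derivative of the current law projected onto `ker A_Cᵀ`, and explicit equations for `i_L'`, `x'`
and `i'` (`Circuit.exists_quasilinear_one`). By positive definiteness a solution of the
homogeneous equations has `e'` in the kernel of `(A_R A_C A_V)ᵀ`, and `i_V'` is a loop of
capacitors and voltage sources; both vanish in the index `1` case. In general, the currents
through the cutsets `ker (A_R A_C A_V)ᵀ` satisfy a constraint. Its first derivative contains the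
explicit expressions for `i_L'` and `i'`, which depend on `e` through positive definite maps, so
that the second derivative determines `e'` (`Circuit.exists_quasilinear_cutset`). Similarly,
eliminating `e'` from the current law by means of the differentiated voltage constraints expresses
`i_V` by the other variables, and a second differentiation determines `i_V'`
(`Circuit.exists_quasilinear_loop`).

For the lower bounds, let `F = 0` and `dF/dt = 0` hold at a point. Without differentiations,
linearizing `x' - Φ = M F` there would make `∂F/∂x'` invertible (`not_reducibleToODE_zero`). With
one differentiation, it suffices to change `x'` and `x''` without violating `F = 0` and
`dF/dt = 0` (`not_reducibleToODE_one`): along a loop of capacitors and voltage sources, `i_V'` is changed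
and `e''` compensates; along a cutset, `e'` is changed, and `i_L''` and the second derivatives of
the element variables compensate. That the element can compensate although its equations are
implicit follows from a rank count (`exists_fderiv_eq_zero_of_obtained`): the coefficient `M₁` of
the differentiated element equations annihilates exactly the image of the Jacobian with respect to
the derivatives, and, since `v'` does not occur in the explicit equations, also the image of
`∂F/∂v`.
-/

set_option linter.unusedSectionVars false

/-! ### Jets and total derivatives -/

section General

variable {X X' W W' U U' : Type*} [NormedAddCommGroup X] [NormedSpace ℝ X]
  [NormedAddCommGroup X'] [NormedSpace ℝ X'] [NormedAddCommGroup W] [NormedSpace ℝ W]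
  [NormedAddCommGroup W'] [NormedSpace ℝ W'] [NormedAddCommGroup U] [NormedSpace ℝ U]
  [NormedAddCommGroup U'] [NormedSpace ℝ U']

namespace Jet

/-- `Jet.trunc` as a continuous linear map. -/
noncomputable def truncL {k m : ℕ} (h : k ≤ m) : Jet m X →L[ℝ] Jet k X :=
  (ContinuousLinearMap.pi fun i : Fin (k + 1) =>
    (ContinuousLinearMap.proj (φ := fun _ : Fin (m + 1) => X)
      (Fin.castLE (Nat.succ_le_succ h) i)).comp (ContinuousLinearMap.fst ℝ _ _)).prod
    (ContinuousLinearMap.snd ℝ _ _)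

theorem contDiff_trunc {r : WithTop ℕ∞} {k m : ℕ} (h : k ≤ m) :
    ContDiff ℝ r (Jet.trunc (X := X) h) := (truncL (X := X) h).contDiff

theorem hasFDerivAt_trunc {k m : ℕ} (h : k ≤ m) (p : Jet m X) :
    HasFDerivAt (Jet.trunc (X := X) h) (truncL h) p := (truncL (X := X) h).hasFDerivAt

/-- The map of jets induced by a continuous linear map of the state spaces. -/
noncomputable def mapL {k : ℕ} (π : X →L[ℝ] X') : Jet k X →L[ℝ] Jet k X' :=
  (ContinuousLinearMap.pi fun i => π.comp ((ContinuousLinearMap.proj i).comp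
    (ContinuousLinearMap.fst ℝ _ _))).prod (ContinuousLinearMap.snd ℝ _ _)

@[simp] theorem mapL_fst {k : ℕ} (π : X →L[ℝ] X') (p : Jet k X) (i : Fin (k + 1)) :
    (mapL π p).1 i = π (p.1 i) := rfl

/-- The entry `x⁽ⁱ⁾` of a jet, as a continuous linear map. -/
noncomputable def entryL {k : ℕ} (i : Fin (k + 1)) : Jet k X →L[ℝ] X :=
  (ContinuousLinearMap.proj i).comp (ContinuousLinearMap.fst ℝ _ _)

/-- The state and the time `(x, t)` of a jet, as a continuous linear map. -/
noncomputable def baseL {k : ℕ} : Jet k X →L[ℝ] X × ℝ :=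
  (entryL 0).prod (ContinuousLinearMap.snd ℝ _ _)

end Jet

theorem totalDeriv_comp_clm {k : ℕ} {H : U → W} (ℓ : Jet k X →L[ℝ] U) (p : Jet (k + 1) X)
    (hH : DifferentiableAt ℝ H (ℓ (p.trunc (Nat.le_succ k)))) :
    totalDeriv (fun q => H (ℓ q)) p =
      fderiv ℝ H (ℓ (p.trunc (Nat.le_succ k))) (ℓ (fun i => p.1 i.succ, 1)) := by
  have := (hH.hasFDerivAt.comp _ ℓ.hasFDerivAt).fderiv
  unfold totalDeriv
  rw [show (fun q => H (ℓ q)) = H ∘ ℓ from rfl, this]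
  rfl

theorem contDiff_totalDeriv {k : ℕ} {G : Jet k X → W} (hG : ContDiff ℝ ∞ G) :
    ContDiff ℝ ∞ (totalDeriv G) := by
  have h1 : ContDiff ℝ ∞ (fderiv ℝ G) := hG.fderiv_right (by simp)
  exact (h1.comp (Jet.truncL (Nat.le_succ k)).contDiff).clm_apply
    (g := fun p : Jet (k + 1) X => (fun i => p.1 i.succ, 1)) (by fun_prop)

theorem contDiff_derivArray {F : X × X × ℝ → W} (hF : ContDiff ℝ ∞ F) :
    ∀ j, ContDiff ℝ ∞ (derivArray F j)
  | 0 => by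
    refine hF.comp (?_ : ContDiff ℝ ∞ fun p : Jet 1 X => (p.1 1, p.1 0, p.2))
    fun_prop
  | j + 1 => contDiff_totalDeriv (contDiff_derivArray hF j)

theorem derivArray_one {F : X × X × ℝ → W} (hF : ContDiff ℝ ∞ F) (p : Jet 2 X) :
    derivArray F 1 p = fderiv ℝ F (p.1 1, p.1 0, p.2) (p.1 2, p.1 1, 1) :=
  totalDeriv_comp_clm (H := F)
    ((Jet.entryL 1).prod ((Jet.entryL 0).prod (ContinuousLinearMap.snd ℝ _ _))) p
    (hF.differentiable (by simp)).differentiableAt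

/-- The derivative array is natural: a linear change of the unknowns under which `F'` becomes a
linear image of `F` has the same effect on all total derivatives. -/
theorem derivArray_mapL {F : X × X × ℝ → W} {F' : X' × X' × ℝ → W'} (hF : ContDiff ℝ ∞ F)
    (hF' : ContDiff ℝ ∞ F') (π : X →L[ℝ] X') (ρ : W →L[ℝ] W')
    (h : ∀ x₁ x t, F' (π x₁, π x, t) = ρ (F (x₁, x, t))) (j : ℕ) :
    ∀ p : Jet (j + 1) X, derivArray F' j (Jet.mapL π p) = ρ (derivArray F j p) := by
  induction j with
  | zero => exact fun p => h _ _ _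
  | succ j ih =>
    intro p
    have d1 := ((contDiff_derivArray hF' j).differentiable (by simp)
      (Jet.mapL π (p.trunc (Nat.le_succ _)))).hasFDerivAt
    have d2 := ((contDiff_derivArray hF j).differentiable (by simp)
      (p.trunc (Nat.le_succ _))).hasFDerivAt
    have e1 := d1.comp _ (Jet.mapL π).hasFDerivAt
    have e2 := ρ.hasFDerivAt.comp _ d2
    rw [show derivArray F' j ∘ Jet.mapL π = ρ ∘ derivArray F j from funext ih] at e1
    exact congrArg (fun A : Jet (j + 1) X →L[ℝ] W' => A (fun i => p.1 i.succ, 1)) (e1.unique e2)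

/-! ### Equations obtained by differentiations and algebraic manipulations -/

namespace ObtainedFrom

variable {r : WithTop ℕ∞} {F : X × X × ℝ → W} {I : Set ℝ} {m n : ℕ}

theorem congr {R R' : Jet (m + 1) X → U} (h : ObtainedFrom r F I m R)
    (hR : ∀ p : Jet (m + 1) X, p.2 ∈ I → R' p = R p) : ObtainedFrom r F I m R' := by
  obtain ⟨M, hM, hMR⟩ := h
  exact ⟨M, hM, fun p hp => (hR p hp).trans (hMR p hp)⟩

theorem of_le {s : WithTop ℕ∞} (hsr : s ≤ r) {R : Jet (m + 1) X → U}
    (h : ObtainedFrom r F I m R) : ObtainedFrom s F I m R := by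
  obtain ⟨M, hM, hMR⟩ := h
  exact ⟨M, fun j => (hM j).of_le hsr, hMR⟩

theorem zero : ObtainedFrom r F I m (fun _ => (0 : U)) :=
  ⟨fun _ _ => 0, fun _ => contDiffOn_const, fun p _ => by simp⟩

theorem of_derivArray {j : ℕ} (hj : j ≤ m) {M : Jet (m + 1) X → (W →L[ℝ] U)}
    (hM : ContDiffOn ℝ r M {p | p.2 ∈ I}) :
    ObtainedFrom r F I m
      (fun p => M p (derivArray F j (p.trunc (Nat.succ_le_succ hj)))) := by
  refine ⟨fun i p => if (i : ℕ) = j then M p else 0, fun i => ?_, fun p _ => ?_⟩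
  · by_cases h : (i : ℕ) = j
    · simpa [h] using hM
    · simpa [h] using contDiffOn_const
  · rw [Finset.sum_eq_single ⟨j, Nat.lt_succ_of_le hj⟩]
    · simp
    · intro b _ hb
      have : (b : ℕ) ≠ j := fun h => hb (Fin.ext h)
      simp [this]
    · simp

theorem add {R R' : Jet (m + 1) X → U} (h : ObtainedFrom r F I m R)
    (h' : ObtainedFrom r F I m R') : ObtainedFrom r F I m (fun p => R p + R' p) := by
  obtain ⟨M, hM, hMR⟩ := h
  obtain ⟨M', hM', hMR'⟩ := h'
  refine ⟨fun j p => M j p + M' j p, fun j => (hM j).add (hM' j), fun p hp => ?_⟩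
  simp [hMR p hp, hMR' p hp, Finset.sum_add_distrib]

theorem sum {ι : Type*} (s : Finset ι) {R : ι → Jet (m + 1) X → U}
    (h : ∀ i ∈ s, ObtainedFrom r F I m (R i)) :
    ObtainedFrom r F I m (fun p => ∑ i ∈ s, R i p) := by
  classical
  induction s using Finset.induction_on with
  | empty => simpa using zero
  | insert a s ha ih =>
    simp only [Finset.sum_insert ha]
    exact (h a (by simp)).add (ih fun i hi => h i (by simp [hi]))

theorem clm_apply {R : Jet (m + 1) X → U} {B : Jet (m + 1) X → (U →L[ℝ] U')}
    (h : ObtainedFrom r F I m R) (hB : ContDiffOn ℝ r B {p | p.2 ∈ I}) :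
    ObtainedFrom r F I m (fun p => B p (R p)) := by
  obtain ⟨M, hM, hMR⟩ := h
  refine ⟨fun j p => (B p).comp (M j p), fun j => hB.clm_comp (hM j), fun p hp => ?_⟩
  simp [hMR p hp, map_sum]

theorem clm {R : Jet (m + 1) X → U} (h : ObtainedFrom r F I m R) (B : U →L[ℝ] U') :
    ObtainedFrom r F I m (fun p => B (R p)) :=
  h.clm_apply (B := fun _ => B) contDiffOn_const

theorem sub {R R' : Jet (m + 1) X → U} (h : ObtainedFrom r F I m R)
    (h' : ObtainedFrom r F I m R') : ObtainedFrom r F I m (fun p => R p - R' p) :=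
  (h.add (h'.clm (-ContinuousLinearMap.id ℝ U))).congr fun p _ => by simp [sub_eq_add_neg]

theorem prodMk {R : Jet (m + 1) X → U} {R' : Jet (m + 1) X → U'} (h : ObtainedFrom r F I m R)
    (h' : ObtainedFrom r F I m R') : ObtainedFrom r F I m (fun p => (R p, R' p)) :=
  ((h.clm (ContinuousLinearMap.inl ℝ U U')).add (h'.clm (ContinuousLinearMap.inr ℝ U U'))).congr
    fun p _ => by simp

theorem lift (hmn : m ≤ n) {R : Jet (m + 1) X → U} (h : ObtainedFrom r F I m R) :
    ObtainedFrom r F I n (fun p => R (p.trunc (Nat.succ_le_succ hmn))) := by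
  obtain ⟨M, hM, hMR⟩ := h
  refine (sum Finset.univ fun j _ => of_derivArray (j.is_le.trans hmn)
    (M := fun p => M j (p.trunc (Nat.succ_le_succ hmn))) ?_).congr fun p hp => hMR _ hp
  exact (hM j).comp (Jet.contDiff_trunc _).contDiffOn fun p hp => hp

/-- An equation obtained with smooth coefficients may be differentiated once more: by the product
rule its total derivative is again a combination of total derivatives of `F`. -/
theorem totalDeriv (hF : ContDiff ℝ ∞ F) (hI : UniqueDiffOn ℝ I) {R : Jet (m + 1) X → U}
    (h : ObtainedFrom ∞ F I m R) (hR : ∀ p : Jet (m + 1) X, p.2 ∈ I → DifferentiableAt ℝ R p) :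
    ObtainedFrom ∞ F I (m + 1) (_root_.totalDeriv R) := by
  obtain ⟨M, hM, hMR⟩ := h
  set s : Set (Jet (m + 1) X) := {p | p.2 ∈ I} with hs_def
  -- the coefficients are smooth on `s` only, so they are differentiated within `s`
  have hs : UniqueDiffOn ℝ s := by
    have : s = Set.univ ×ˢ I := by ext p; simp [hs_def]
    rw [this]
    exact uniqueDiffOn_univ.prod hI
  have key : ∀ j : Fin (m + 1), ObtainedFrom ∞ F I (m + 1) (fun p : Jet (m + 1 + 1) X =>
      fderivWithin ℝ (M j) s (p.trunc (Nat.le_succ _)) (fun i => p.1 i.succ, 1)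
          (derivArray F j (p.trunc (Nat.succ_le_succ (j.is_le.trans (Nat.le_succ m)))))
        + M j (p.trunc (Nat.le_succ _))
          (derivArray F (j + 1) (p.trunc (Nat.succ_le_succ (Nat.succ_le_succ j.is_le))))) := by
    intro j
    refine ObtainedFrom.add (of_derivArray (M := fun p : Jet (m + 1 + 1) X =>
      fderivWithin ℝ (M j) s (p.trunc (Nat.le_succ _)) (fun i => p.1 i.succ, 1))
        (j.is_le.trans (Nat.le_succ m)) ?_)
      (of_derivArray (M := fun p : Jet (m + 1 + 1) X => M j (p.trunc (Nat.le_succ _)))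
        (Nat.succ_le_succ j.is_le) ?_)
    · have h1 : ContDiffOn ℝ ∞ (fderivWithin ℝ (M j) s) s :=
        (hM j).fderivWithin hs (by simp)
      exact (h1.comp (s := {p : Jet (m + 1 + 1) X | p.2 ∈ I})
        (Jet.contDiff_trunc (Nat.le_succ (m + 1))).contDiffOn fun p hp => hp).clm_apply
        (g := fun p : Jet (m + 1 + 1) X => (fun i : Fin (m + 1 + 1) => p.1 i.succ, 1))
        (ContDiff.contDiffOn (by fun_prop))
    · exact (hM j).comp (Jet.contDiff_trunc _).contDiffOn fun p hp => hp
  refine (sum Finset.univ fun j _ => key j).congr fun p hp => ?_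
  have hq : p.trunc (Nat.le_succ _) ∈ s := hp
  have hsum : HasFDerivWithinAt (fun q : Jet (m + 1) X => ∑ j : Fin (m + 1),
      M j q (derivArray F j (q.trunc (Nat.succ_le_succ j.is_le)))) _ s (p.trunc (Nat.le_succ _)) :=
    HasFDerivWithinAt.fun_sum fun j _ =>
      (((hM j).differentiableOn (by simp)) _ hq).hasFDerivWithinAt.clm_apply
        (((contDiff_derivArray hF j).differentiable (by simp) _).hasFDerivAt.comp
          (p.trunc (Nat.le_succ _)) (Jet.hasFDerivAt_trunc _ _)).hasFDerivWithinAt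
  have hR' := (hsum.congr (fun q hq' => hMR q hq') (hMR _ hq)).fderivWithin (hs _ hq)
  rw [(hR _ hp).fderivWithin (hs _ hq)] at hR'
  unfold _root_.totalDeriv
  rw [hR']
  simp only [sum_apply, add_apply]
  exact Finset.sum_congr rfl fun j _ => add_comm _ _

/-- An equation obtained from a subsystem is obtained from the whole system. -/
theorem map {F' : X' × X' × ℝ → W'} (hF : ContDiff ℝ ∞ F) (hF' : ContDiff ℝ ∞ F')
    (π : X →L[ℝ] X') (ρ : W →L[ℝ] W') (hρ : ∀ x₁ x t, F' (π x₁, π x, t) = ρ (F (x₁, x, t)))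
    {R : Jet (m + 1) X' → U} (h : ObtainedFrom r F' I m R) :
    ObtainedFrom r F I m (fun p => R (Jet.mapL π p)) := by
  obtain ⟨M, hM, hMR⟩ := h
  refine ⟨fun j p => (M j (Jet.mapL π p)).comp ρ, fun j => ?_, fun p hp => ?_⟩
  · exact ((hM j).comp (f := Jet.mapL π) (Jet.mapL π).contDiff.contDiffOn
      fun p hp => hp).clm_comp contDiffOn_const
  · refine (hMR (Jet.mapL π p) hp).trans ?_
    refine Finset.sum_congr rfl fun j _ => ?_
    rw [ContinuousLinearMap.comp_apply, ← derivArray_mapL hF hF' π ρ hρ]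
    rfl

end ObtainedFrom

end General

section General

variable {X W U Y : Type*} [NormedAddCommGroup X] [NormedSpace ℝ X]
  [NormedAddCommGroup W] [NormedSpace ℝ W] [NormedAddCommGroup U] [NormedSpace ℝ U]
  [NormedAddCommGroup Y] [NormedSpace ℝ Y]

/-! ### Quasilinear equations -/

/-- A left inverse of injective linear maps that depends smoothly on the map: in Euclidean
coordinates it is `(AᵀA)⁻¹Aᵀ`. -/
theorem exists_contDiffAt_leftInverse (X Y : Type*) [NormedAddCommGroup X] [NormedSpace ℝ X]
    [NormedAddCommGroup Y] [NormedSpace ℝ Y] [FiniteDimensional ℝ X] [FiniteDimensional ℝ Y] :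
    ∃ G : (X →L[ℝ] Y) → (Y →L[ℝ] X), ∀ A : X →L[ℝ] Y, Function.Injective A →
      ContDiffAt ℝ ∞ G A ∧ ∀ x, G A (A x) = x := by
  let eX := toEuclidean (E := X)
  let eY := toEuclidean (E := Y)
  let EX := EuclideanSpace ℝ (Fin (Module.finrank ℝ X))
  let EY := EuclideanSpace ℝ (Fin (Module.finrank ℝ Y))
  let adj : (EX →L[ℝ] EY) →ₗ[ℝ] (EY →L[ℝ] EX) :=
    { toFun := fun B => ContinuousLinearMap.adjoint B
      map_add' := fun B B' => map_add _ B B'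
      map_smul' := fun c B => by simp }
  let adjL := LinearMap.toContinuousLinearMap adj
  let coord : (X →L[ℝ] Y) → (EX →L[ℝ] EY) := fun A =>
    (eY : Y →L[ℝ] EY).comp (A.comp (eX.symm : EX →L[ℝ] X))
  have hcoord : ContDiff ℝ ∞ coord :=
    contDiff_const.clm_comp (contDiff_id.clm_comp contDiff_const)
  let gram : (X →L[ℝ] Y) → (EX →L[ℝ] EX) := fun A => (adjL (coord A)).comp (coord A)
  have hadj : ContDiff ℝ ∞ fun A => adjL (coord A) := adjL.contDiff.comp hcoord
  have hgram : ContDiff ℝ ∞ gram := hadj.clm_comp hcoord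
  refine ⟨fun A => (eX.symm : EX →L[ℝ] X).comp ((ContinuousLinearMap.inverse (gram A)).comp
    ((adjL (coord A)).comp (eY : Y →L[ℝ] EY))), fun A hA => ?_⟩
  have hinj : Function.Injective (gram A) := by
    rw [injective_iff_map_eq_zero]
    intro x hx
    have h1 : inner ℝ (coord A x) (coord A x) = 0 := by
      rw [← ContinuousLinearMap.adjoint_inner_left]
      have : ContinuousLinearMap.adjoint (coord A) (coord A x) = 0 := hx
      rw [this, inner_zero_left]
    have h2 : eY (A (eX.symm x)) = 0 := inner_self_eq_zero.1 h1
    rw [map_eq_zero_iff _ eY.injective, map_eq_zero_iff _ hA,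
      map_eq_zero_iff _ eX.symm.injective] at h2
    exact h2
  obtain ⟨e, he⟩ : ∃ e : EX ≃L[ℝ] EX, (e : EX →L[ℝ] EX) = gram A :=
    ⟨(LinearEquiv.ofInjectiveEndo (gram A : EX →ₗ[ℝ] EX) hinj).toContinuousLinearEquiv,
      by ext x; rfl⟩
  have hinv : ContDiffAt ℝ ∞ ContinuousLinearMap.inverse (gram A) :=
    he ▸ contDiffAt_map_inverse e
  constructor
  · exact contDiffAt_const.clm_comp (((hinv.comp A hgram.contDiffAt)).clm_comp
      (hadj.contDiffAt.clm_comp contDiffAt_const))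
  · intro x
    have h1 : gram A (eX x) = adjL (coord A) (eY (A x)) := by
      change adjL (coord A) (eY (A (eX.symm (eX x)))) = _
      rw [eX.symm_apply_apply]
    change eX.symm (ContinuousLinearMap.inverse (gram A) (adjL (coord A) (eY (A x)))) = x
    rw [← h1, ← he, ContinuousLinearMap.inverse_equiv]
    simp

/-- The functions of `(x, t)` that are smooth at all points with time in `I`. -/
def SmoothAtTimes (I : Set ℝ) (h : X × ℝ → U) : Prop :=
  ∀ z : X × ℝ, z.2 ∈ I → ContDiffAt ℝ ∞ h z

/-- The equation `A (x, t) x' = b (x, t)`, with smooth `A` and `b`, is obtained from `F = 0` with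
`m` differentiations and smooth coefficients. -/
structure ObtainedQuasilinear (F : X × X × ℝ → W) (I : Set ℝ) (m : ℕ)
    (A : X × ℝ → (X →L[ℝ] U)) (b : X × ℝ → U) : Prop where
  smooth_coeff : SmoothAtTimes I A
  smooth_rhs : SmoothAtTimes I b
  obtained : ObtainedFrom ∞ F I m fun p => A (p.1 0, p.2) (p.1 1) - b (p.1 0, p.2)

variable {F : X × X × ℝ → W} {I : Set ℝ} {m : ℕ}

/-- If the function `h` vanishes along the system, so does its derivative along solutions. -/
theorem ObtainedFrom.deriv_along (hF : ContDiff ℝ ∞ F) (hI : UniqueDiffOn ℝ I) {h : X × ℝ → U}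
    (hh : SmoothAtTimes I h) (H : ObtainedFrom ∞ F I m fun p => h (p.1 0, p.2)) :
    ObtainedFrom ∞ F I (m + 1) fun p => fderiv ℝ h (p.1 0, p.2) (p.1 1, 1) := by
  have hd : ∀ p : Jet (m + 1) X, p.2 ∈ I → DifferentiableAt ℝ h (p.1 0, p.2) :=
    fun p hp => (hh _ hp).differentiableAt (by simp)
  refine (H.totalDeriv hF hI fun p hp => ?_).congr fun p hp => ?_
  · exact (hd p hp).comp (f := Jet.baseL) p (Jet.baseL (X := X) (k := m + 1)).differentiableAt
  · exact (totalDeriv_comp_clm Jet.baseL p (hd (p.trunc (Nat.le_succ _)) hp)).symm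

theorem ObtainedFrom.quasilinear_deriv (hF : ContDiff ℝ ∞ F) (hI : UniqueDiffOn ℝ I)
    {h : X × ℝ → U} (hh : SmoothAtTimes I h)
    (H : ObtainedFrom ∞ F I m fun p => h (p.1 0, p.2)) :
    ObtainedQuasilinear F I (m + 1) (fun z => (fderiv ℝ h z).comp (ContinuousLinearMap.inl ℝ X ℝ))
      (fun z => -fderiv ℝ h z (0, 1)) where
  smooth_coeff z hz := ((hh z hz).fderiv_right (by simp)).clm_comp contDiffAt_const
  smooth_rhs z hz := (((hh z hz).fderiv_right (by simp)).clm_apply contDiffAt_const).neg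
  obtained := (H.deriv_along hF hI hh).congr fun p _ => by
    simp [← map_add]

namespace ObtainedQuasilinear

theorem prod {A : X × ℝ → (X →L[ℝ] U)} {b : X × ℝ → U} {A' : X × ℝ → (X →L[ℝ] Y)}
    {b' : X × ℝ → Y} (h : ObtainedQuasilinear F I m A b) (h' : ObtainedQuasilinear F I m A' b') :
    ObtainedQuasilinear F I m (fun z => (A z).prod (A' z)) (fun z => (b z, b' z)) where
  smooth_coeff z hz := by
    have h1 : ContDiffAt ℝ ∞ (fun z => (ContinuousLinearMap.inl ℝ U Y).comp (A z)
        + (ContinuousLinearMap.inr ℝ U Y).comp (A' z)) z :=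
      (contDiffAt_const.clm_comp (h.smooth_coeff z hz)).add
        (contDiffAt_const.clm_comp (h'.smooth_coeff z hz))
    convert h1 using 2 with y
    ext <;> simp
  smooth_rhs z hz := (h.smooth_rhs z hz).prodMk (h'.smooth_rhs z hz)
  obtained := (h.obtained.prodMk h'.obtained).congr fun p _ => rfl

theorem lift {n : ℕ} (hmn : m ≤ n) {A : X × ℝ → (X →L[ℝ] U)} {b : X × ℝ → U}
    (h : ObtainedQuasilinear F I m A b) : ObtainedQuasilinear F I n A b :=
  ⟨h.smooth_coeff, h.smooth_rhs, h.obtained.lift hmn⟩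

theorem reducibleToODE [FiniteDimensional ℝ X] [FiniteDimensional ℝ U]
    {A : X × ℝ → (X →L[ℝ] U)} {b : X × ℝ → U} (h : ObtainedQuasilinear F I m A b)
    (hA : ∀ z : X × ℝ, z.2 ∈ I → Function.Injective (A z)) : ReducibleToODE F I m := by
  obtain ⟨G, hG⟩ := exists_contDiffAt_leftInverse X U
  have hGA : ∀ z : X × ℝ, z.2 ∈ I → ContDiffAt ℝ ∞ (fun z => G (A z)) z := fun z hz =>
    (hG _ (hA z hz)).1.comp z (h.smooth_coeff z hz)
  refine ⟨fun z => G (A z) (b z), fun z hz =>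
    ((hGA z hz).clm_apply (h.smooth_rhs z hz)).continuousAt.continuousWithinAt, ?_⟩
  refine ((h.obtained.clm_apply (B := fun p => G (A (p.1 0, p.2))) fun p hp => ?_).of_le
    (by simp)).congr fun p hp => ?_
  · exact ((hGA (p.1 0, p.2) hp).comp (f := Jet.baseL) p
      (Jet.baseL (X := X) (k := m + 1)).contDiff.contDiffAt).contDiffWithinAt
  · rw [map_sub, (hG _ (hA _ hp)).2]

end ObtainedQuasilinear

/-! ### Obstructions to a reduction -/

theorem hasDerivAt_add_smul (x δ : X) : HasDerivAt (fun s : ℝ => x + s • δ) δ 0 := by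
  simpa using ((hasDerivAt_id (0 : ℝ)).smul_const δ).const_add x

/-- The derivative of `M F` at a zero of `F` exists as soon as `M` is continuous. -/
theorem hasDerivAt_clm_apply_of_eq_zero {M : ℝ → (W →L[ℝ] U)} {f : ℝ → W} {f' : W} {s : ℝ}
    (hM : ContinuousAt M s) (hf : HasDerivAt f f' s) (h0 : f s = 0) :
    HasDerivAt (fun s => M s (f s)) (M s f') s := by
  rw [hasDerivAt_iff_tendsto_slope] at hf ⊢
  have hM' : Filter.Tendsto M (nhdsWithin s {s}ᶜ) (nhds (M s)) :=
    hM.mono_left nhdsWithin_le_nhds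
  refine ((isBoundedBilinearMap_apply (𝕜 := ℝ) (E := W) (F := U)).continuous.tendsto
    (M s, f') |>.comp (hM'.prodMk_nhds hf)).congr fun y => by simp [slope, h0]

/-- An equation that is obtained from `F = 0` can be linearized at a common zero of the total
derivatives of `F`, at a fixed time. -/
theorem ObtainedFrom.linearize {r : WithTop ℕ∞} (hF : ContDiff ℝ ∞ F) {R : Jet (m + 1) X → U}
    {M : Fin (m + 1) → Jet (m + 1) X → (W →L[ℝ] U)}
    (hM : ∀ j, ContDiffOn ℝ r (M j) {p | p.2 ∈ I})
    (hR : ∀ p : Jet (m + 1) X, p.2 ∈ I →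
      R p = ∑ j : Fin (m + 1), M j p (derivArray F j (p.trunc (Nat.succ_le_succ j.is_le))))
    {p : Jet (m + 1) X} (hp : p.2 ∈ I)
    (h0 : ∀ j : Fin (m + 1), derivArray F j (p.trunc (Nat.succ_le_succ j.is_le)) = 0)
    (δ : Fin (m + 1 + 1) → X) {R' : U} (hR' : HasDerivAt (fun s : ℝ => R (p + s • (δ, 0))) R' 0) :
    R' = ∑ j : Fin (m + 1), M j p (fderiv ℝ (derivArray F j) (p.trunc (Nat.succ_le_succ j.is_le))
      (Jet.trunc (Nat.succ_le_succ j.is_le) ((δ, 0) : Jet (m + 1) X))) := by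
  have hmem : ∀ s : ℝ, p + s • ((δ, 0) : Jet (m + 1) X) ∈ {p : Jet (m + 1) X | p.2 ∈ I} :=
    fun s => by simpa using hp
  have hline := hasDerivAt_add_smul p ((δ, 0) : Jet (m + 1) X)
  have h00 : p + (0 : ℝ) • ((δ, 0) : Jet (m + 1) X) = p := by simp
  have key := HasDerivAt.fun_sum (u := Finset.univ) fun (j : Fin (m + 1)) _ =>
    hasDerivAt_clm_apply_of_eq_zero (s := 0)
      (M := fun s : ℝ => M j (p + s • ((δ, 0) : Jet (m + 1) X)))
      (f := fun s : ℝ => derivArray F j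
        (Jet.truncL (Nat.succ_le_succ j.is_le) (p + s • ((δ, 0) : Jet (m + 1) X))))
      (((hM j).continuousOn.comp_continuous (by fun_prop) hmem).continuousAt)
      ((((contDiff_derivArray hF j).differentiable (by simp)) _).hasFDerivAt.comp_hasDerivAt (0 : ℝ)
        ((Jet.truncL (X := X) (k := j + 1) (m := m + 1)
          (Nat.succ_le_succ j.is_le)).hasFDerivAt.comp_hasDerivAt (0 : ℝ) hline))
      (by rw [h00]; exact h0 j)
  have e := hR'.unique (key.congr_of_eventuallyEq (Filter.Eventually.of_forall fun s =>
    hR _ (hmem s)))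
  rw [e]
  refine Finset.sum_congr rfl fun j _ => ?_
  simp only [h00]
  rfl

/-- A differential-algebraic system is not an explicit ODE in disguise: without differentiations,
`x' = Φ (x, t)` would make `∂F/∂x'` left invertible at every zero of `F`. -/
theorem not_reducibleToODE_zero [FiniteDimensional ℝ X] {F : X × X × ℝ → X}
    (hF : ContDiff ℝ ∞ F) (hDAE : IsDAE F I) (hcons : IsConsistent F I m) :
    ¬ ReducibleToODE F I 0 := by
  rintro ⟨Φ, -, M, hM, hR⟩
  obtain ⟨q, hq, hq0⟩ := hcons
  let p : Jet 1 X := q.trunc (Nat.succ_le_succ (Nat.zero_le m))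
  have hline : HasFDerivAt (fun y : X => F (y, p.1 0, p.2))
      ((fderiv ℝ F (p.1 1, p.1 0, p.2)).comp (ContinuousLinearMap.inl ℝ X (X × ℝ))) (p.1 1) :=
    (hF.differentiable (by simp) _).hasFDerivAt.comp (p.1 1)
      ((hasFDerivAt_id (p.1 1)).prodMk (hasFDerivAt_const (p.1 0, p.2) (p.1 1)))
  have hdet := hDAE (p.1 1) (p.1 0) p.2 hq
  rw [hline.fderiv] at hdet
  obtain ⟨δ, hδ, hδ0⟩ : ∃ δ, fderiv ℝ F (p.1 1, p.1 0, p.2) (δ, 0) = 0 ∧ δ ≠ 0 := by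
    obtain ⟨δ, hδ, hδ0⟩ := (Submodule.ne_bot_iff _).1 (LinearMap.bot_lt_ker_of_det_eq_zero hdet).ne'
    exact ⟨δ, hδ, hδ0⟩
  have hR' : HasDerivAt (fun s : ℝ => (fun p : Jet 1 X => p.1 1 - Φ (p.1 0, p.2))
      (p + s • ((![0, δ], 0) : Jet 1 X))) δ 0 := by
    have : (fun s : ℝ => (fun p : Jet 1 X => p.1 1 - Φ (p.1 0, p.2))
        (p + s • ((![0, δ], 0) : Jet 1 X))) = fun s => p.1 1 + s • δ - Φ (p.1 0, p.2) := by
      ext s; simp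
    rw [this]
    exact (hasDerivAt_add_smul (p.1 1) δ).sub_const (Φ (p.1 0, p.2))
  have e := ObtainedFrom.linearize hF hM hR (p := p) hq
    (fun j => by obtain rfl : j = 0 := Fin.fin_one_eq_zero j; exact hq0 0) ![0, δ] hR'
  apply hδ0
  rw [e]
  refine Finset.sum_eq_zero fun j _ => ?_
  obtain rfl : j = 0 := Fin.fin_one_eq_zero j
  let ℓ : Jet 1 X →L[ℝ] X × X × ℝ :=
    (Jet.entryL 1).prod ((Jet.entryL 0).prod (ContinuousLinearMap.snd ℝ _ _))
  have h1 : fderiv ℝ (derivArray F 0) p = (fderiv ℝ F (p.1 1, p.1 0, p.2)).comp ℓ :=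
    ((hF.differentiable (by simp) (ℓ p)).hasFDerivAt.comp p ℓ.hasFDerivAt).fderiv
  have h2 : fderiv ℝ (derivArray F 0) p (![0, δ], 0) = 0 := by
    rw [h1]; exact hδ
  exact (congrArg _ h2).trans (map_zero _)

theorem fderiv_eq_of_invariant {δ : X} (hinv : ∀ x₁ x t, F (x₁ + δ, x, t) = F (x₁, x, t))
    (x₁ x : X) (t : ℝ) : fderiv ℝ F (x₁ + δ, x, t) = fderiv ℝ F (x₁, x, t) := by
  have h1 := fderiv_comp_add_right (𝕜 := ℝ) (f := F) (x := (x₁, x, t)) (δ, 0, 0)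
  have h2 : (fun z : X × X × ℝ => F (z + (δ, 0, 0))) = F := by
    ext ⟨x₁, x, t⟩
    simpa using hinv x₁ x t
  rw [h2] at h1
  simpa using h1.symm

/-- One differentiation is not enough if `x'` is not determined by the values of `x` and `t` and the
equations `F = 0`, `dF/dt = 0`: the system does not see the change `δ₁` of `x'`, and in `dF/dt` it
is compensated by the change `δ₂` of `x''`. -/
theorem not_reducibleToODE_one (hF : ContDiff ℝ ∞ F) {p : Jet 2 X} (hp : p.2 ∈ I)
    (hp0 : derivArray F 0 (p.trunc (Nat.le_succ 1)) = 0) (hp1 : derivArray F 1 p = 0)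
    {δ₁ δ₂ : X} (hδ₁ : δ₁ ≠ 0) (hinv : ∀ x₁ x t, F (x₁ + δ₁, x, t) = F (x₁, x, t))
    (hδ : fderiv ℝ F (p.1 1, p.1 0, p.2) (δ₂, δ₁, 0) = 0) : ¬ ReducibleToODE F I 1 := by
  rintro ⟨Φ, -, M, hM, hR⟩
  have key : ∀ q : Jet 2 X, q.2 ∈ I → derivArray F 0 (q.trunc (Nat.le_succ 1)) = 0 →
      derivArray F 1 q = 0 → q.1 1 - Φ (q.1 0, q.2) = 0 := by
    intro q hq h0 h1
    refine (hR q hq).trans ?_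
    rw [Fin.sum_univ_two]
    exact (congrArg₂ (· + ·) ((congrArg (M 0 q) h0).trans (map_zero _))
      ((congrArg (M 1 q) h1).trans (map_zero _))).trans (add_zero _)
  have hp' := key p hp hp0 hp1
  have hq' := key (![p.1 0, p.1 1 + δ₁, p.1 2 + δ₂], p.2) hp ((hinv _ _ _).trans hp0) (by
    rw [derivArray_one hF] at hp1 ⊢
    have hvec : (p.1 2 + δ₂, p.1 1 + δ₁, (1 : ℝ)) = (p.1 2, p.1 1, 1) + (δ₂, δ₁, 0) := by simp
    change fderiv ℝ F (p.1 1 + δ₁, p.1 0, p.2) (p.1 2 + δ₂, p.1 1 + δ₁, 1) = 0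
    rw [fderiv_eq_of_invariant hinv, hvec, map_add, hp1, hδ, add_zero])
  apply hδ₁
  change p.1 1 + δ₁ - Φ (p.1 0, p.2) = 0 at hq'
  rw [add_sub_right_comm, hp', zero_add] at hq'
  exact hq'

end General

section General

variable {X W : Type*} [NormedAddCommGroup X] [NormedSpace ℝ X]
  [NormedAddCommGroup W] [NormedSpace ℝ W]

/-- In a direction `δ₁` of `x'` that `F` does not see, `dF/dt` has the same linearization as
`F` at `(δ₂, δ₁)`. -/
theorem fderiv_derivArray_one {F : X × X × ℝ → W} (hF : ContDiff ℝ ∞ F) (p : Jet 2 X) {δ₁ : X}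
    (δ₂ : X) (hinv : ∀ (s : ℝ) x₁ x t, F (x₁ + s • δ₁, x, t) = F (x₁, x, t)) :
    fderiv ℝ (derivArray F 1) p (![0, δ₁, δ₂], 0) =
      fderiv ℝ F (p.1 1, p.1 0, p.2) (δ₂, δ₁, 0) := by
  have hline := hasDerivAt_add_smul p ((![0, δ₁, δ₂], 0) : Jet 2 X)
  have h1 := (((contDiff_derivArray hF 1).differentiable (by simp)
    (p + (0 : ℝ) • ((![0, δ₁, δ₂], 0) : Jet 2 X))).hasFDerivAt).comp_hasDerivAt (0 : ℝ) hline
  have h2 : derivArray F 1 ∘ (fun s : ℝ => p + s • ((![0, δ₁, δ₂], 0) : Jet 2 X)) =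
      fun s : ℝ => fderiv ℝ F (p.1 1, p.1 0, p.2) (p.1 2, p.1 1, 1)
        + s • fderiv ℝ F (p.1 1, p.1 0, p.2) (δ₂, δ₁, 0) := by
    ext s
    rw [Function.comp_apply, derivArray_one hF, ← map_smul, ← map_add]
    simp [fderiv_eq_of_invariant (hinv s)]
  rw [h2] at h1
  have h3 := hasDerivAt_add_smul (fderiv ℝ F (p.1 1, p.1 0, p.2) (p.1 2, p.1 1, 1))
    (fderiv ℝ F (p.1 1, p.1 0, p.2) (δ₂, δ₁, 0))
  simpa using h1.unique h3

/-- Suppose that the square system `G (y', y, v, t) = 0` determines `y'` after one differentiation.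
Counting ranks shows that the coefficient `M₁` of `dG/dt` has `ker M₁ = im ∂G/∂y'`; since `M₁` also
eliminates `v'` from `dG/dt`, the image of `∂G/∂v` is contained in that of `∂G/∂y'`. -/
theorem exists_fderiv_eq_zero_of_obtained {Y T : Type*} [NormedAddCommGroup Y] [NormedSpace ℝ Y]
    [FiniteDimensional ℝ Y] [NormedAddCommGroup T] [NormedSpace ℝ T] {r : WithTop ℕ∞} {I : Set ℝ}
    {G : (Y × T) × (Y × T) × ℝ → Y} (hG : ContDiff ℝ ∞ G)
    (hinv : ∀ y v v' x t, G ((y, v), x, t) = G ((y, v'), x, t))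
    {R : Jet 2 (Y × T) → Y} (hR : ObtainedFrom r G I 1 R) {p : Jet 2 (Y × T)} (hp : p.2 ∈ I)
    (hp0 : derivArray G 0 (p.trunc (Nat.le_succ 1)) = 0) (hp1 : derivArray G 1 p = 0)
    {J : Y →ₗ[ℝ] Y} (hJ : Function.Injective J)
    (hRJ : ∀ δ₁ δ₂ : Y × T, HasDerivAt (fun s : ℝ => R (p + s • (![0, δ₁, δ₂], 0))) (J δ₁.1) 0)
    (u : T) : ∃ y : Y, fderiv ℝ G (p.1 1, p.1 0, p.2) ((y, 0), (0, u), 0) = 0 := by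
  obtain ⟨M, hM, hMR⟩ := hR
  have hlin : ∀ δ₁ δ₂ : Y × T, J δ₁.1 = M 0 p (fderiv ℝ G (p.1 1, p.1 0, p.2) (δ₁, 0, 0))
      + M 1 p (fderiv ℝ (derivArray G 1) p (![0, δ₁, δ₂], 0)) := by
    intro δ₁ δ₂
    have h := ObtainedFrom.linearize hG hM hMR hp
      (fun j => by fin_cases j; exacts [hp0, hp1]) ![0, δ₁, δ₂] (hRJ δ₁ δ₂)
    rw [Fin.sum_univ_two] at h
    rw [h]
    let ℓ : Jet 1 (Y × T) →L[ℝ] (Y × T) × (Y × T) × ℝ :=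
      (Jet.entryL 1).prod ((Jet.entryL 0).prod (ContinuousLinearMap.snd ℝ _ _))
    have h1 : fderiv ℝ (derivArray G 0) (p.trunc (Nat.le_succ 1)) =
        (fderiv ℝ G (p.1 1, p.1 0, p.2)).comp ℓ :=
      ((hG.differentiable (by simp) (ℓ (p.trunc (Nat.le_succ 1)))).hasFDerivAt.comp _
        ℓ.hasFDerivAt).fderiv
    exact congrArg₂ (· + ·) (congrArg (M 0 p) (congrArg (fun A : Jet 1 (Y × T) →L[ℝ] Y =>
      A (Jet.trunc (Nat.le_succ 1) (![0, δ₁, δ₂], 0))) h1)) rfl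
  let E : Y →ₗ[ℝ] Y := ((fderiv ℝ G (p.1 1, p.1 0, p.2)).comp
    ((ContinuousLinearMap.inl ℝ (Y × T) ((Y × T) × ℝ)).comp
      (ContinuousLinearMap.inl ℝ Y T))).toLinearMap
  have hE : ∀ y, E y = fderiv ℝ G (p.1 1, p.1 0, p.2) ((y, 0), 0, 0) := fun y => rfl
  let M₁ : Y →ₗ[ℝ] Y := (M 1 p).toLinearMap
  have hM₁E : LinearMap.range E ≤ LinearMap.ker M₁ := by
    rintro _ ⟨y, rfl⟩
    have h := hlin 0 (y, 0)
    rw [fderiv_derivArray_one hG p (y, 0) (by simp)] at h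
    have h0 : fderiv ℝ G (p.1 1, p.1 0, p.2) ((0 : Y × T), (0 : Y × T), (0 : ℝ)) = 0 := map_zero _
    rw [h0] at h
    simpa [hE, M₁] using h.symm
  -- `R` does not contain `v'`
  have hM₁v : fderiv ℝ G (p.1 1, p.1 0, p.2) (0, (0, u), 0) ∈ LinearMap.ker M₁ := by
    have hinv' : ∀ (s : ℝ) (x₁ x : Y × T) t,
        G (x₁ + s • ((0, u) : Y × T), x, t) = G (x₁, x, t) := fun s x₁ x t => by
      rw [show x₁ + s • ((0, u) : Y × T) = (x₁.1, x₁.2 + s • u) by ext <;> simp]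
      exact hinv _ _ _ _ _
    have h := hlin (0, u) 0
    rw [fderiv_derivArray_one hG p 0 hinv'] at h
    have h0 : fderiv ℝ G (p.1 1, p.1 0, p.2) ((0, u), 0, 0) = 0 := by
      have hc : HasDerivAt (fun s : ℝ => G (p.1 1 + s • (0, u), p.1 0, p.2)) 0 0 := by
        simp only [hinv']
        exact hasDerivAt_const _ _
      have hl : HasDerivAt (fun s : ℝ => (p.1 1 + s • ((0, u) : Y × T), p.1 0, p.2))
          ((0, u), 0, 0) 0 :=
        (hasDerivAt_add_smul (p.1 1) (0, u)).prodMk (hasDerivAt_const _ _)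
      have hd := ((hG.differentiable (by simp)
        (p.1 1 + (0 : ℝ) • ((0, u) : Y × T), p.1 0, p.2)).hasFDerivAt).comp_hasDerivAt (0 : ℝ) hl
      simpa using hd.unique hc
    rw [h0] at h
    simpa [M₁] using h.symm
  -- by `hlin`, `J = M₀ E + M₁ (…)`, hence `J` maps `ker E` into the range of `M₁`
  have hJE : Module.finrank ℝ (LinearMap.ker E) ≤ Module.finrank ℝ (LinearMap.range M₁) := by
    have hmem : ∀ y : LinearMap.ker E, J y ∈ LinearMap.range M₁ := by
      rintro ⟨y, hy⟩
      have h := hlin (y, 0) 0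
      rw [show fderiv ℝ G (p.1 1, p.1 0, p.2) ((y, 0), 0, 0) = 0 from hy, map_zero, zero_add] at h
      exact ⟨_, h.symm⟩
    refine LinearMap.finrank_le_finrank_of_injective
      (f := (J.comp (LinearMap.ker E).subtype).codRestrict (LinearMap.range M₁) hmem) ?_
    intro y y' h
    exact Subtype.ext (hJ (congrArg Subtype.val h))
  have heq : LinearMap.range E = LinearMap.ker M₁ := by
    refine Submodule.eq_of_le_of_finrank_le hM₁E ?_
    have h1 := LinearMap.finrank_range_add_finrank_ker E
    have h2 := LinearMap.finrank_range_add_finrank_ker M₁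
    omega
  rw [← heq] at hM₁v
  obtain ⟨y, hy⟩ := hM₁v
  refine ⟨-y, ?_⟩
  have : ((-y, (0 : T)), ((0 : Y), u), (0 : ℝ)) = -((y, 0), 0, 0) + (0, (0, u), 0) := by
    ext <;> simp
  rw [this, map_add, map_neg, ← hE, hy, neg_add_cancel]

end General

/-! ### Inductance-like elements as explicit systems -/

namespace IsInductanceLike

variable {D Λ : Type*} [Fintype D] [Fintype Λ] {I : Set ℝ}
  {F : (D → ℝ) × (Λ → ℝ) × (D → ℝ) × (Λ → ℝ) × (Λ → ℝ) × ℝ → (D → ℝ) × (Λ → ℝ)}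

theorem contDiff_elementDAE (hF : ContDiff ℝ ∞ F) : ContDiff ℝ ∞ (elementDAE F) := by
  refine hF.comp (?_ : ContDiff ℝ ∞ fun p : (((D → ℝ) × (Λ → ℝ)) × (Λ → ℝ)) ×
    (((D → ℝ) × (Λ → ℝ)) × (Λ → ℝ)) × ℝ =>
      (p.1.1.1, p.1.1.2, p.2.1.1.1, p.2.1.1.2, p.2.1.2, p.2.2))
  fun_prop

theorem totalDeriv_flux {φ : (Λ → ℝ) × (D → ℝ) × ℝ → (Λ → ℝ)} (hφ : ContDiff ℝ ∞ φ)
    (p : Jet 1 (((D → ℝ) × (Λ → ℝ)) × (Λ → ℝ))) :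
    totalDeriv (fun q : Jet 0 (((D → ℝ) × (Λ → ℝ)) × (Λ → ℝ)) =>
      φ ((q.1 0).1.2, (q.1 0).1.1, q.2)) p =
    fderiv ℝ φ ((p.1 0).1.2, (p.1 0).1.1, p.2) ((p.1 1).1.2, (p.1 1).1.1, 1) := by
  let ℓ : Jet 0 (((D → ℝ) × (Λ → ℝ)) × (Λ → ℝ)) →L[ℝ] (Λ → ℝ) × (D → ℝ) × ℝ :=
    (((ContinuousLinearMap.snd ℝ _ _).comp (ContinuousLinearMap.fst ℝ _ _)).comp
      (Jet.entryL 0)).prod ((((ContinuousLinearMap.fst ℝ _ _).comp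
        (ContinuousLinearMap.fst ℝ _ _)).comp (Jet.entryL 0)).prod (ContinuousLinearMap.snd ℝ _ _))
  exact totalDeriv_comp_clm (H := φ) ℓ p (hφ.differentiable (by simp) _)

theorem fderiv_current {φ : (Λ → ℝ) × (D → ℝ) × ℝ → (Λ → ℝ)} (hφ : ContDiff ℝ ∞ φ) (i x t) :
    fderiv ℝ (fun i' => φ (i', x, t)) i =
      (fderiv ℝ φ (i, x, t)).comp (ContinuousLinearMap.inl ℝ _ _) :=
  ((hφ.differentiable (by simp) (i, x, t)).hasFDerivAt.comp i
    ((hasFDerivAt_id i).prodMk (hasFDerivAt_const (x, t) i))).fderiv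

theorem fderiv_internal {φ : (Λ → ℝ) × (D → ℝ) × ℝ → (Λ → ℝ)} (hφ : ContDiff ℝ ∞ φ) (i x t y) :
    fderiv ℝ (fun x' => φ (i, x', t)) x y = fderiv ℝ φ (i, x, t) (0, y, 0) := by
  have := ((hφ.differentiable (by simp) (i, x, t)).hasFDerivAt.comp (f := fun x' => (i, x', t)) x
    ((hasFDerivAt_const i x).prodMk
      ((hasFDerivAt_id x).prodMk (hasFDerivAt_const t x)))).fderiv
  exact congrArg (fun A : (D → ℝ) →L[ℝ] (Λ → ℝ) => A y) this

theorem deriv_time {φ : (Λ → ℝ) × (D → ℝ) × ℝ → (Λ → ℝ)} (hφ : ContDiff ℝ ∞ φ) (i x t) :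
    deriv (fun s => φ (i, x, s)) t = fderiv ℝ φ (i, x, t) (0, 0, 1) :=
  ((hφ.differentiable (by simp) (i, x, t)).hasFDerivAt.comp_hasDerivAt t
    ((hasDerivAt_const t i).prodMk ((hasDerivAt_const t x).prodMk (hasDerivAt_id t)))).deriv

/-- At a point where the element equations and their first derivative hold, a change `u` of the
derivative of the voltages can be compensated in the differentiated element equations by a change
of the second derivatives of the internal variables and the currents. -/
theorem exists_compensation (h : IsInductanceLike I F)
    {p : Jet 2 (((D → ℝ) × (Λ → ℝ)) × (Λ → ℝ))} (hp : p.2 ∈ I)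
    (hp0 : derivArray (elementDAE F) 0 (p.trunc (Nat.le_succ 1)) = 0)
    (hp1 : derivArray (elementDAE F) 1 p = 0) (u : Λ → ℝ) :
    ∃ y, fderiv ℝ (elementDAE F) (p.1 1, p.1 0, p.2) ((y, 0), (0, u), 0) = 0 := by
  obtain ⟨hF, φ, fx, fφ, hφ, -, -, hRx, hRφ, hreg, -⟩ := h
  let z := ((p.1 0).1.2, (p.1 0).1.1, p.2)
  let J : (D → ℝ) × (Λ → ℝ) →ₗ[ℝ] (D → ℝ) × (Λ → ℝ) :=
    (LinearMap.fst ℝ (D → ℝ) (Λ → ℝ)).prod ((fderiv ℝ φ z).toLinearMap.comp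
      ((LinearMap.snd ℝ _ _).prod ((LinearMap.fst ℝ _ _).prod 0)))
  have hJ : ∀ y, J y = (y.1, fderiv ℝ φ z (y.2, y.1, 0)) := fun y => rfl
  refine exists_fderiv_eq_zero_of_obtained (contDiff_elementDAE hF) (fun _ _ _ _ _ => rfl)
    (hRx.prodMk hRφ) hp hp0 hp1 (J := J) ?_ (fun δ₁ δ₂ => ?_) u
  · rw [injective_iff_map_eq_zero]
    rintro ⟨yx, yi⟩ hy
    rw [hJ, Prod.mk_eq_zero] at hy
    obtain ⟨rfl, hy⟩ := hy
    have hinj : Function.Injective (fderiv ℝ (fun i' => φ (i', (p.1 0).1.1, p.2)) (p.1 0).1.2) := by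
      obtain ⟨e, he⟩ := hreg (p.1 0).1.2 (p.1 0).1.1 p.2 hp
      rw [← he]
      exact e.injective
    rw [fderiv_current hφ] at hinj
    have : yi = 0 := hinj ((show _ = (0 : Λ → ℝ) from hy).trans (map_zero _).symm)
    simp [this]
  · have h1 := hasDerivAt_add_smul (p.1 1).1.1 δ₁.1.1
    have h2 := hasDerivAt_add_smul (p.1 1).1.2 δ₁.1.2
    have h3 := (h1.sub_const (fx ((p.1 0).1.1, (p.1 0).1.2, (p.1 0).2, p.2))).prodMk
      (((fderiv ℝ φ z).hasFDerivAt.comp_hasDerivAt (0 : ℝ)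
        (h2.prodMk (h1.prodMk (hasDerivAt_const (0 : ℝ) (1 : ℝ))))).sub_const
        (fφ ((p.1 0).1.1, (p.1 0).1.2, (p.1 0).2, p.2)))
    rw [hJ]
    refine h3.congr_of_eventuallyEq (Filter.Eventually.of_forall fun s => ?_)
    simp [totalDeriv_flux hφ, Jet.trunc, z, Fin.castLE]

/-- The element equations imply explicit equations `x' = f_x (x, i, v, t)` and
`i' = f_i (x, i, v, t)` with `∂f_i/∂v` positive definite. -/
theorem exists_explicit (h : IsInductanceLike I F) :
    ∃ (fx : (D → ℝ) × (Λ → ℝ) × (Λ → ℝ) × ℝ → (D → ℝ))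
      (fi : (D → ℝ) × (Λ → ℝ) × (Λ → ℝ) × ℝ → (Λ → ℝ)),
      ContDiff ℝ ∞ fx ∧ (∀ x i v, ∀ t ∈ I, ContDiffAt ℝ ∞ fi (x, i, v, t)) ∧
      ObtainedFrom ∞ (elementDAE F) I 1 (fun p : Jet 2 (((D → ℝ) × (Λ → ℝ)) × (Λ → ℝ)) =>
        (p.1 1).1.1 - fx ((p.1 0).1.1, (p.1 0).1.2, (p.1 0).2, p.2)) ∧
      ObtainedFrom ∞ (elementDAE F) I 1 (fun p : Jet 2 (((D → ℝ) × (Λ → ℝ)) × (Λ → ℝ)) =>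
        (p.1 1).1.2 - fi ((p.1 0).1.1, (p.1 0).1.2, (p.1 0).2, p.2)) ∧
      ∀ x i v, ∀ t ∈ I, IsPosDef (fderiv ℝ (fun v' => fi (x, i, v', t)) v) := by
  obtain ⟨hF, φ, fx, fφ, hφ, hfx, hfφ, hRx, hRφ, hreg, hpos⟩ := h
  simp only [fderiv_current hφ, fderiv_internal hφ, deriv_time hφ] at hreg hpos
  let Dφ : (D → ℝ) × (Λ → ℝ) × (Λ → ℝ) × ℝ → ((Λ → ℝ) × (D → ℝ) × ℝ →L[ℝ] (Λ → ℝ)) :=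
    fun z => fderiv ℝ φ (z.2.1, z.1, z.2.2.2)
  let Jinv : (D → ℝ) × (Λ → ℝ) × (Λ → ℝ) × ℝ → ((Λ → ℝ) →L[ℝ] (Λ → ℝ)) := fun z =>
    ((Dφ z).comp (ContinuousLinearMap.inl ℝ (Λ → ℝ) ((D → ℝ) × ℝ))).inverse
  have hDφ : ContDiff ℝ ∞ Dφ :=
    (hφ.fderiv_right (m := ∞) (by simp)).comp
      (g := fderiv ℝ φ) (f := fun z : (D → ℝ) × (Λ → ℝ) × (Λ → ℝ) × ℝ => (z.2.1, z.1, z.2.2.2))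
      (by fun_prop)
  have hJinv : ∀ x i v, ∀ t ∈ I, ContDiffAt ℝ ∞ Jinv (x, i, v, t) := by
    intro x i v t ht
    obtain ⟨e, he⟩ := hreg i x t ht
    have h1 : ContDiffAt ℝ ∞ ContinuousLinearMap.inverse
        ((Dφ (x, i, v, t)).comp (ContinuousLinearMap.inl ℝ (Λ → ℝ) ((D → ℝ) × ℝ))) :=
      he ▸ contDiffAt_map_inverse e
    exact h1.comp (x, i, v, t) (hDφ.contDiffAt.clm_comp contDiffAt_const)
  refine ⟨fx, fun z => Jinv z (-(Dφ z (0, fx z, 0)) - Dφ z (0, 0, 1) + fφ z), hfx,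
    fun x i v t ht => (hJinv x i v t ht).clm_apply ?_, hRx, ?_, hpos⟩
  · refine ContDiff.contDiffAt ?_
    exact ((hDφ.clm_apply (by fun_prop)).neg.sub (hDφ.clm_apply contDiff_const)).add hfφ
  · let ζ : Jet 2 (((D → ℝ) × (Λ → ℝ)) × (Λ → ℝ)) → (D → ℝ) × (Λ → ℝ) × (Λ → ℝ) × ℝ :=
      fun p => ((p.1 0).1.1, (p.1 0).1.2, (p.1 0).2, p.2)
    have hζ : ContDiff ℝ ∞ ζ := by fun_prop
    have hB : ContDiffOn ℝ ∞ (fun p => Jinv (ζ p))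
        {p : Jet 2 (((D → ℝ) × (Λ → ℝ)) × (Λ → ℝ)) | p.2 ∈ I} := fun p hp =>
      ((hJinv _ _ (p.1 0).2 _ hp).comp (g := Jinv) (f := ζ) p hζ.contDiffAt).contDiffWithinAt
    let ι := (ContinuousLinearMap.inr ℝ (Λ → ℝ) ((D → ℝ) × ℝ)).comp
      (ContinuousLinearMap.inl ℝ (D → ℝ) ℝ)
    have hB' : ContDiffOn ℝ ∞ (fun p => (Jinv (ζ p)).comp ((Dφ (ζ p)).comp ι))
        {p : Jet 2 (((D → ℝ) × (Λ → ℝ)) × (Λ → ℝ)) | p.2 ∈ I} :=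
      hB.clm_comp ((hDφ.comp hζ).clm_comp contDiff_const).contDiffOn
    refine ((hRφ.clm_apply hB).sub (hRx.clm_apply hB')).congr fun p hp => ?_
    obtain ⟨e, he⟩ := hreg (p.1 0).1.2 (p.1 0).1.1 p.2 hp
    have hinv : Jinv (ζ p) (Dφ (ζ p) ((p.1 1).1.2, 0, 0)) = (p.1 1).1.2 := by
      have h1 : Dφ (ζ p) ((p.1 1).1.2, 0, 0) = e (p.1 1).1.2 :=
        (congrArg (fun A : (Λ → ℝ) →L[ℝ] (Λ → ℝ) => A (p.1 1).1.2) he).symm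
      have h2 : Jinv (ζ p) = e.symm := by
        change ContinuousLinearMap.inverse _ = _
        rw [← ContinuousLinearMap.inverse_equiv, he]
      rw [h1, h2]
      simp
    have hsplit : Dφ (ζ p) ((p.1 1).1.2, (p.1 1).1.1, 1) =
        Dφ (ζ p) ((p.1 1).1.2, 0, 0) + Dφ (ζ p) (0, (p.1 1).1.1, 0) + Dφ (ζ p) (0, 0, 1) := by
      rw [← map_add, ← map_add]
      simp
    have htot : totalDeriv (fun q : Jet 0 (((D → ℝ) × (Λ → ℝ)) × (Λ → ℝ)) =>
        φ ((q.1 0).1.2, (q.1 0).1.1, q.2)) (p.trunc one_le_two) =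
        Dφ (ζ p) ((p.1 1).1.2, (p.1 1).1.1, 1) := totalDeriv_flux hφ _
    have hι : ∀ y, (Dφ (ζ p)).comp ι y = Dφ (ζ p) (0, y, 0) := fun y => rfl
    rw [htot, hsplit, ContinuousLinearMap.comp_apply, ← map_sub, map_sub ((Dφ (ζ p)).comp ι),
      hι, hι]
    change (p.1 1).1.2 - Jinv (ζ p) (-(Dφ (ζ p) (0, fx (ζ p), 0)) - Dφ (ζ p) (0, 0, 1) + fφ (ζ p))
      = Jinv (ζ p) (_ - fφ (ζ p) - (_ - Dφ (ζ p) (0, fx (ζ p), 0)))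
    nth_rewrite 1 [← hinv]
    rw [← map_sub]
    congr 1
    abel

end IsInductanceLike

/-! ### Linear algebra of incidence matrices and positive definite maps -/

section LinearAlgebra

variable {N B B' : Type*} [Fintype N] [Fintype B] [Fintype B']

/-- Multiplication of vectors by a matrix, as a continuous linear map. -/
noncomputable def mulVecL (A : Matrix N B ℝ) : (B → ℝ) →L[ℝ] (N → ℝ) :=
  LinearMap.toContinuousLinearMap A.mulVecLin

@[simp] theorem mulVecL_apply (A : Matrix N B ℝ) (v : B → ℝ) : mulVecL A v = A *ᵥ v := rfl

theorem dotProduct_mulVec_eq_transpose (A : Matrix N B ℝ) (w : N → ℝ) (y : B → ℝ) :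
    w ⬝ᵥ A *ᵥ y = Aᵀ *ᵥ w ⬝ᵥ y := by
  rw [Matrix.dotProduct_mulVec, Matrix.mulVec_transpose]

theorem transpose_fromCols_mulVec_eq_zero {A : Matrix N B ℝ} {A' : Matrix N B' ℝ} {w : N → ℝ} :
    (Matrix.fromCols A A')ᵀ *ᵥ w = 0 ↔ Aᵀ *ᵥ w = 0 ∧ A'ᵀ *ᵥ w = 0 := by
  rw [Matrix.transpose_fromCols, Matrix.fromRows_mulVec]
  constructor
  · intro h
    exact ⟨funext fun b => congrFun h (Sum.inl b), funext fun b => congrFun h (Sum.inr b)⟩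
  · rintro ⟨h, h'⟩
    ext (b | b)
    · exact congrFun h b
    · exact congrFun h' b

/-- `P` is the orthogonal projector onto `ker Aᵀ`. -/
structure IsKerTransposeProjector (A : Matrix N B ℝ) (P : (N → ℝ) →L[ℝ] (N → ℝ)) : Prop where
  mem : ∀ v, Aᵀ *ᵥ P v = 0
  eq_self : ∀ w, Aᵀ *ᵥ w = 0 → P w = w
  apply_mulVec : ∀ y, P (A *ᵥ y) = 0
  dotProduct_apply : ∀ v w, Aᵀ *ᵥ w = 0 → w ⬝ᵥ P v = w ⬝ᵥ v

theorem isKerTransposeProjector_iff {A : Matrix N B ℝ} {P : (N → ℝ) →L[ℝ] (N → ℝ)} :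
    IsKerTransposeProjector A P ↔ (∀ v, Aᵀ *ᵥ P v = 0) ∧ (∀ w, Aᵀ *ᵥ w = 0 → P w = w) ∧
      (∀ y, P (A *ᵥ y) = 0) ∧ ∀ v w, Aᵀ *ᵥ w = 0 → w ⬝ᵥ P v = w ⬝ᵥ v :=
  ⟨fun h => ⟨h.1, h.2, h.3, h.4⟩, fun h => ⟨h.1, h.2.1, h.2.2.1, h.2.2.2⟩⟩

theorem exists_isKerTransposeProjector (A : Matrix N B ℝ) :
    ∃ P, IsKerTransposeProjector A P := by
  let e := EuclideanSpace.equiv N ℝ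
  let K : Submodule ℝ (EuclideanSpace ℝ N) := LinearMap.ker (Aᵀ.mulVecLin ∘ₗ e.toLinearMap)
  have hK : ∀ x, x ∈ K ↔ Aᵀ *ᵥ e x = 0 := fun x => Iff.rfl
  have hinner : ∀ x y : EuclideanSpace ℝ N, inner ℝ x y = e x ⬝ᵥ e y := fun x y => by
    rw [EuclideanSpace.inner_eq_star_dotProduct, dotProduct_comm]
    rfl
  refine ⟨(e : _ →L[ℝ] (N → ℝ)).comp (K.starProjection.comp (e.symm : (N → ℝ) →L[ℝ] _)),
    ⟨fun v => ?_, fun w hw => ?_, fun y => ?_, fun v w hw => ?_⟩⟩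
  · exact (hK _).1 (K.starProjection_apply_mem (e.symm v))
  · have h : e.symm w ∈ K := (hK _).2 (by simpa using hw)
    simp [Submodule.starProjection_eq_self_iff.2 h]
  · have h : e.symm (A *ᵥ y) ∈ Kᗮ := by
      rw [Submodule.mem_orthogonal]
      intro u hu
      rw [hinner, e.apply_symm_apply, dotProduct_mulVec_eq_transpose, (hK u).1 hu, zero_dotProduct]
    simp [(Submodule.starProjection_apply_eq_zero_iff (K := K)).2 h]
  · have h : e.symm w ∈ K := (hK _).2 (by simpa using hw)
    have h1 := K.starProjection_inner_eq_zero (e.symm v) (e.symm w) h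
    rw [real_inner_comm, inner_sub_right, hinner, hinner, e.apply_symm_apply,
      e.apply_symm_apply] at h1
    exact (sub_eq_zero.1 h1).symm

namespace IsPosDef

theorem eq_zero {T : (B → ℝ) →L[ℝ] (B → ℝ)} (hT : IsPosDef T) {u : B → ℝ}
    (hu : u ⬝ᵥ T u ≤ 0) : u = 0 := by
  by_contra h
  exact absurd (hT u h) (not_lt.2 hu)

theorem nonneg {T : (B → ℝ) →L[ℝ] (B → ℝ)} (hT : IsPosDef T) (u : B → ℝ) : 0 ≤ u ⬝ᵥ T u := by
  by_cases h : u = 0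
  · simp [h]
  · exact (hT u h).le

theorem exists_equiv {T : (B → ℝ) →L[ℝ] (B → ℝ)} (hT : IsPosDef T) :
    ∃ e : (B → ℝ) ≃L[ℝ] (B → ℝ), (e : (B → ℝ) →L[ℝ] (B → ℝ)) = T := by
  have hinj : Function.Injective (T : (B → ℝ) →ₗ[ℝ] (B → ℝ)) := by
    rw [injective_iff_map_eq_zero]
    intro u hu
    refine hT.eq_zero ?_
    rw [show T u = 0 from hu, dotProduct_zero]
  exact ⟨(LinearEquiv.ofInjectiveEndo _ hinj).toContinuousLinearEquiv, by ext x; rfl⟩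

theorem inverse {T : (B → ℝ) →L[ℝ] (B → ℝ)} (hT : IsPosDef T) : IsPosDef T.inverse := by
  obtain ⟨e, he⟩ := hT.exists_equiv
  rw [← he, ContinuousLinearMap.inverse_equiv]
  intro u hu
  have h := hT (e.symm u) (by simpa using hu)
  rw [← he] at h
  rw [dotProduct_comm]
  simpa using h

end IsPosDef

/-- The range of `A T Aᵀ`, with `T` positive definite, is the orthogonal complement of `ker Aᵀ`. -/
theorem exists_mulVec_posDef_eq {A : Matrix N B ℝ} {T : (B → ℝ) →L[ℝ] (B → ℝ)} (hT : IsPosDef T)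
    {y : N → ℝ} (hy : ∀ w, Aᵀ *ᵥ w = 0 → w ⬝ᵥ y = 0) : ∃ d, A *ᵥ T (Aᵀ *ᵥ d) = y := by
  obtain ⟨P, hP⟩ := exists_isKerTransposeProjector A
  -- `A T Aᵀ + P` is injective, hence onto
  let K : (N → ℝ) →ₗ[ℝ] (N → ℝ) := A.mulVecLin ∘ₗ T.toLinearMap ∘ₗ Aᵀ.mulVecLin + P.toLinearMap
  have hK : ∀ d, K d = A *ᵥ T (Aᵀ *ᵥ d) + P d := fun d => rfl
  have hinj : Function.Injective K := by
    rw [injective_iff_map_eq_zero]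
    intro d hd
    have h1 : d ⬝ᵥ K d = 0 := by rw [hd, dotProduct_zero]
    have h2 : d ⬝ᵥ P d = P d ⬝ᵥ P d := by
      rw [hP.dotProduct_apply d (P d) (hP.mem d), dotProduct_comm]
    rw [hK, dotProduct_add, dotProduct_mulVec_eq_transpose, h2] at h1
    have h3 : Aᵀ *ᵥ d = 0 := hT.eq_zero (by
      have : 0 ≤ P d ⬝ᵥ P d := Finset.sum_nonneg fun i _ => mul_self_nonneg _
      linarith)
    rw [h3, map_zero, dotProduct_zero, zero_add, dotProduct_self_eq_zero, hP.eq_self d h3] at h1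
    exact h1
  obtain ⟨d, hd⟩ := LinearMap.surjective_of_injective hinj y
  refine ⟨d, ?_⟩
  have h1 : P d ⬝ᵥ K d = 0 := hd ▸ hy _ (hP.mem d)
  rw [hK, dotProduct_add, dotProduct_mulVec_eq_transpose, hP.mem, zero_dotProduct, zero_add,
    dotProduct_self_eq_zero] at h1
  rw [← hd, hK, h1, add_zero]

end LinearAlgebra

section PartialDerivative

variable {E W : Type*} [NormedAddCommGroup E] [NormedSpace ℝ E] [NormedAddCommGroup W]
  [NormedSpace ℝ W]

theorem fderiv_prodMk_left {f : E × ℝ → W} (hf : ContDiff ℝ ∞ f) (v : E) (t : ℝ) :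
    fderiv ℝ (fun v' => f (v', t)) v = (fderiv ℝ f (v, t)).comp (ContinuousLinearMap.inl ℝ E ℝ) :=
  ((hf.differentiable (by simp) (v, t)).hasFDerivAt.comp v
    ((hasFDerivAt_id v).prodMk (hasFDerivAt_const t v))).fderiv

/-- A derivative computed along a line. -/
theorem fderiv_eq_of_hasDerivAt_line {f : E → W} {x δ : E} {f' : W} (hf : DifferentiableAt ℝ f x)
    (h : HasDerivAt (fun s : ℝ => f (x + s • δ)) f' 0) : fderiv ℝ f x δ = f' := by
  have hf' : HasFDerivAt f (fderiv ℝ f x) (x + (0 : ℝ) • δ) := by simpa using hf.hasFDerivAt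
  exact (hf'.comp_hasDerivAt (0 : ℝ) (hasDerivAt_add_smul x δ)).unique h

end PartialDerivative

/-! ### The coupled system -/

namespace Circuit

/-- The states `(e, i_L, i_V, x, i)` of the coupled system. -/
abbrev State (N L V D Λ : Type*) := (N → ℝ) × (L → ℝ) × (V → ℝ) × (D → ℝ) × (Λ → ℝ)

variable {N C R L V J Λ D : Type*} {S : Circuit N C R L V J Λ}
  [Fintype N] [Fintype C] [Fintype R] [Fintype L] [Fintype V] [Fintype J] [Fintype Λ] [Fintype D]
  {F : (D → ℝ) × (Λ → ℝ) × (D → ℝ) × (Λ → ℝ) × (Λ → ℝ) × ℝ → (D → ℝ) × (Λ → ℝ)}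

theorem IsSmooth.coupledDAE (hS : S.IsSmooth) (hF : ContDiff ℝ ∞ F) :
    ContDiff ℝ ∞ (S.coupledDAE F) := by
  have hq := hS.q
  have hg := hS.g
  have hφ := hS.φL
  have hi := hS.isrc
  have hv := hS.vsrc
  have hDq : ContDiff ℝ ∞ (fderiv ℝ S.q) := hq.fderiv_right (by simp)
  have hDφ : ContDiff ℝ ∞ (fderiv ℝ S.φL) := hφ.fderiv_right (by simp)
  change ContDiff ℝ ∞ fun z : State N L V D Λ × State N L V D Λ × ℝ =>
    (mulVecL S.AC (fderiv ℝ S.q (mulVecL S.ACᵀ z.2.1.1, z.2.2) (mulVecL S.ACᵀ z.1.1, 1))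
        + mulVecL S.AR (S.g (mulVecL S.ARᵀ z.2.1.1, z.2.2))
        + mulVecL S.AL z.2.1.2.1 + mulVecL S.AV z.2.1.2.2.1 + mulVecL S.AΛ z.2.1.2.2.2.2
        + mulVecL S.AI (S.isrc z.2.2),
      fderiv ℝ S.φL (z.2.1.2.1, z.2.2) (z.1.2.1, 1) - mulVecL S.ALᵀ z.2.1.1,
      mulVecL S.AVᵀ z.2.1.1 - S.vsrc z.2.2,
      F (z.1.2.2.2.1, z.1.2.2.2.2, z.2.1.2.2.2.1, z.2.1.2.2.2.2, mulVecL S.AΛᵀ z.2.1.1, z.2.2))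
  fun_prop

/-- The variables `((x, i), v)` of the element as functions of the state. -/
noncomputable def elementVar (S : Circuit N C R L V J Λ) :
    State N L V D Λ →L[ℝ] ((D → ℝ) × (Λ → ℝ)) × (Λ → ℝ) :=
  (((ContinuousLinearMap.snd ℝ _ _).comp (ContinuousLinearMap.snd ℝ _ _)).comp
    (ContinuousLinearMap.snd ℝ _ _)).prod ((mulVecL S.AΛᵀ).comp (ContinuousLinearMap.fst ℝ _ _))

@[simp] theorem elementVar_apply (x : State N L V D Λ) :
    S.elementVar x = (x.2.2.2, S.AΛᵀ *ᵥ x.1) := rfl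

/-- The element equations within the coupled system. -/
noncomputable def elementEqs : State N L V D Λ →L[ℝ] (D → ℝ) × (Λ → ℝ) :=
  ((ContinuousLinearMap.snd ℝ _ _).comp (ContinuousLinearMap.snd ℝ _ _)).comp
    (ContinuousLinearMap.snd ℝ _ _)

theorem elementDAE_elementVar (x₁ x : State N L V D Λ) (t : ℝ) :
    elementDAE F (S.elementVar x₁, S.elementVar x, t) = elementEqs (S.coupledDAE F (x₁, x, t)) :=
  rfl

theorem noCVLoop_iff {Q : Matrix N N ℝ} (hQ : S.IsProjectorQC Q) :
    S.NoCVLoop Q ↔ ∀ i, (∀ w, S.ACᵀ *ᵥ w = 0 → w ⬝ᵥ S.AV *ᵥ i = 0) → i = 0 := by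
  have key : ∀ i, (Qᵀ * S.AV) *ᵥ i = 0 ↔ ∀ w, S.ACᵀ *ᵥ w = 0 → w ⬝ᵥ S.AV *ᵥ i = 0 := by
    intro i
    have hmem : ∀ w, S.ACᵀ *ᵥ w = 0 ↔ ∃ u, Q *ᵥ u = w := fun w => by
      have h : w ∈ LinearMap.range Q.mulVecLin ↔ w ∈ LinearMap.ker S.ACᵀ.mulVecLin := by rw [hQ.2]
      exact h.symm
    constructor
    · intro h w hw
      obtain ⟨u, rfl⟩ := (hmem w).1 hw
      rw [dotProduct_comm, dotProduct_mulVec_eq_transpose, Matrix.mulVec_mulVec, h,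
        zero_dotProduct]
    · intro h
      rw [← dotProduct_self_eq_zero]
      nth_rewrite 1 [← Matrix.mulVec_mulVec]
      rw [← dotProduct_mulVec_eq_transpose, dotProduct_comm]
      exact h _ ((hmem _).2 ⟨_, rfl⟩)
  rw [NoCVLoop, LinearMap.ker_eq_bot']
  exact forall_congr' fun i => imp_congr_left (key i)

theorem noLIΛCutset_iff : S.NoLIΛCutset ↔
    ∀ w, S.ARᵀ *ᵥ w = 0 → S.ACᵀ *ᵥ w = 0 → S.AVᵀ *ᵥ w = 0 → w = 0 := by
  rw [NoLIΛCutset, LinearMap.ker_eq_bot']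
  simp only [Matrix.mulVecLin_apply, transpose_fromCols_mulVec_eq_zero, and_imp]

theorem WellPosed.eq_zero {I : Set ℝ} (hS : S.WellPosed I) {w : N → ℝ} (hR : S.ARᵀ *ᵥ w = 0)
    (hC : S.ACᵀ *ᵥ w = 0) (hV : S.AVᵀ *ᵥ w = 0) (hL : S.ALᵀ *ᵥ w = 0) (hΛ : S.AΛᵀ *ᵥ w = 0) :
    w = 0 := by
  have h := hS.noICutset
  rw [LinearMap.ker_eq_bot'] at h
  simp only [Matrix.mulVecLin_apply, transpose_fromCols_mulVec_eq_zero, and_imp] at h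
  exact h w hR hC hV hL hΛ

theorem WellPosed.posDef_q {I : Set ℝ} (hS : S.WellPosed I) (hsmooth : S.IsSmooth) (v) {t}
    (ht : t ∈ I) :
    IsPosDef ((fderiv ℝ S.q (v, t)).comp (ContinuousLinearMap.inl ℝ (C → ℝ) ℝ)) := by
  rw [← fderiv_prodMk_left hsmooth.q]
  exact hS.posDefC v t ht

theorem WellPosed.posDef_g {I : Set ℝ} (hS : S.WellPosed I) (hsmooth : S.IsSmooth) (v) {t}
    (ht : t ∈ I) :
    IsPosDef ((fderiv ℝ S.g (v, t)).comp (ContinuousLinearMap.inl ℝ (R → ℝ) ℝ)) := by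
  rw [← fderiv_prodMk_left hsmooth.g]
  exact hS.posDefG v t ht

theorem WellPosed.posDef_φL {I : Set ℝ} (hS : S.WellPosed I) (hsmooth : S.IsSmooth) (i) {t}
    (ht : t ∈ I) :
    IsPosDef ((fderiv ℝ S.φL (i, t)).comp (ContinuousLinearMap.inl ℝ (L → ℝ) ℝ)) := by
  rw [← fderiv_prodMk_left hsmooth.φL]
  exact hS.posDefL i t ht

end Circuit

namespace Circuit

variable {N C R L V J Λ D : Type*} {S : Circuit N C R L V J Λ}
  [Fintype N] [Fintype C] [Fintype R] [Fintype L] [Fintype V] [Fintype J] [Fintype Λ] [Fintype D]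
  {F : (D → ℝ) × (Λ → ℝ) × (D → ℝ) × (Λ → ℝ) × (Λ → ℝ) × ℝ → (D → ℝ) × (Λ → ℝ)} {I : Set ℝ}

/-- The sum of all currents at the nodes except for the capacitor currents. -/
noncomputable def nodeCurrent (S : Circuit N C R L V J Λ) (z : State N L V D Λ × ℝ) : N → ℝ :=
  S.AR *ᵥ S.g (S.ARᵀ *ᵥ z.1.1, z.2) + S.AL *ᵥ z.1.2.1 + S.AV *ᵥ z.1.2.2.1
    + S.AΛ *ᵥ z.1.2.2.2.2 + S.AI *ᵥ S.isrc z.2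

theorem IsSmooth.nodeCurrent (hS : S.IsSmooth) :
    ContDiff ℝ ∞ (S.nodeCurrent (D := D)) := by
  have hg := hS.g
  have hi := hS.isrc
  change ContDiff ℝ ∞ fun z : State N L V D Λ × ℝ =>
    mulVecL S.AR (S.g (mulVecL S.ARᵀ z.1.1, z.2)) + mulVecL S.AL z.1.2.1 + mulVecL S.AV z.1.2.2.1
      + mulVecL S.AΛ z.1.2.2.2.2 + mulVecL S.AI (S.isrc z.2)
  fun_prop

/-- The derivative `∂q/∂v` of the charges at the state `z`. -/
noncomputable def capacitance (S : Circuit N C R L V J Λ) (z : State N L V D Λ × ℝ) :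
    (C → ℝ) →L[ℝ] (C → ℝ) :=
  (fderiv ℝ S.q (S.ACᵀ *ᵥ z.1.1, z.2)).comp (ContinuousLinearMap.inl ℝ (C → ℝ) ℝ)

/-- The matrix `A_C (∂q/∂v) A_Cᵀ` at the state `z`. -/
noncomputable def nodalCapacitance (S : Circuit N C R L V J Λ) (z : State N L V D Λ × ℝ) :
    (N → ℝ) →L[ℝ] (N → ℝ) :=
  (mulVecL S.AC).comp ((S.capacitance z).comp (mulVecL S.ACᵀ))

theorem nodalCapacitance_apply (z : State N L V D Λ × ℝ) (e : N → ℝ) :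
    S.nodalCapacitance z e = S.AC *ᵥ S.capacitance z (S.ACᵀ *ᵥ e) := rfl

/-- The part `A_C ∂q/∂t` of the capacitor currents. -/
noncomputable def chargeDrift (S : Circuit N C R L V J Λ) (z : State N L V D Λ × ℝ) : N → ℝ :=
  S.AC *ᵥ fderiv ℝ S.q (S.ACᵀ *ᵥ z.1.1, z.2) (0, 1)

theorem IsSmooth.fderiv_q (hS : S.IsSmooth) : ContDiff ℝ ∞ fun z : State N L V D Λ × ℝ =>
    fderiv ℝ S.q (S.ACᵀ *ᵥ z.1.1, z.2) := by
  have hDq : ContDiff ℝ ∞ (fderiv ℝ S.q) := hS.q.fderiv_right (by simp)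
  change ContDiff ℝ ∞ fun z : State N L V D Λ × ℝ => fderiv ℝ S.q (mulVecL S.ACᵀ z.1.1, z.2)
  fun_prop

theorem IsSmooth.nodalCapacitance (hS : S.IsSmooth) :
    ContDiff ℝ ∞ (S.nodalCapacitance (D := D)) :=
  contDiff_const.clm_comp ((hS.fderiv_q.clm_comp contDiff_const).clm_comp contDiff_const)

theorem IsSmooth.chargeDrift (hS : S.IsSmooth) : ContDiff ℝ ∞ (S.chargeDrift (D := D)) :=
  (mulVecL S.AC).contDiff.comp (hS.fderiv_q.clm_apply contDiff_const)

theorem WellPosed.eq_zero_of_capacitance (hS : S.WellPosed I) (hsmooth : S.IsSmooth)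
    {z : State N L V D Λ × ℝ} (hz : z.2 ∈ I) {e : N → ℝ}
    (h : e ⬝ᵥ S.nodalCapacitance z e ≤ 0) : S.ACᵀ *ᵥ e = 0 := by
  refine (hS.posDef_q hsmooth (S.ACᵀ *ᵥ z.1.1) hz).eq_zero ?_
  rw [nodalCapacitance_apply, dotProduct_mulVec_eq_transpose] at h
  exact h

theorem obtainedFrom_self : ObtainedFrom ∞ (S.coupledDAE F) I 0
    (fun p => S.coupledDAE F (p.1 1, p.1 0, p.2)) :=
  ObtainedFrom.of_derivArray (j := 0) le_rfl
    (M := fun _ => ContinuousLinearMap.id ℝ (State N L V D Λ)) contDiffOn_const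

/-- Kirchhoff's current law in the form `A_C (∂q/∂v) A_Cᵀ e' = - (…)`. -/
theorem quasilinear_kcl (hS : S.IsSmooth) : ObtainedQuasilinear (S.coupledDAE F) I 0
    (fun z => (S.nodalCapacitance z).comp (ContinuousLinearMap.fst ℝ _ _))
    (fun z => -(S.chargeDrift z + S.nodeCurrent z)) where
  smooth_coeff z _ := (hS.nodalCapacitance.clm_comp contDiff_const).contDiffAt
  smooth_rhs z _ := (hS.chargeDrift.add hS.nodeCurrent).neg.contDiffAt
  obtained := (obtainedFrom_self.clm (ContinuousLinearMap.fst ℝ _ _)).congr fun p _ => by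
    have h : fderiv ℝ S.q (S.ACᵀ *ᵥ (p.1 0).1, p.2) (S.ACᵀ *ᵥ (p.1 1).1, 1) =
        fderiv ℝ S.q (S.ACᵀ *ᵥ (p.1 0).1, p.2) (S.ACᵀ *ᵥ (p.1 1).1, 0) +
        fderiv ℝ S.q (S.ACᵀ *ᵥ (p.1 0).1, p.2) (0, 1) := by
      rw [← map_add]; simp
    change S.AC *ᵥ fderiv ℝ S.q (S.ACᵀ *ᵥ (p.1 0).1, p.2) (S.ACᵀ *ᵥ (p.1 1).1, 0) -
      -(S.AC *ᵥ fderiv ℝ S.q (S.ACᵀ *ᵥ (p.1 0).1, p.2) (0, 1) + (S.AR *ᵥ _ + _ + _ + _ + _)) =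
      S.AC *ᵥ fderiv ℝ S.q (S.ACᵀ *ᵥ (p.1 0).1, p.2) (S.ACᵀ *ᵥ (p.1 1).1, 1) + S.AR *ᵥ _ + _ + _
        + _ + _
    rw [h, Matrix.mulVec_add]
    abel

/-- The constraint of the voltage sources. -/
noncomputable def voltageConstraint (S : Circuit N C R L V J Λ) (z : State N L V D Λ × ℝ) :
    V → ℝ :=
  S.AVᵀ *ᵥ z.1.1 - S.vsrc z.2

theorem IsSmooth.voltageConstraint (hS : S.IsSmooth) :
    ContDiff ℝ ∞ (S.voltageConstraint (D := D)) := by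
  have hv := hS.vsrc
  change ContDiff ℝ ∞ fun z : State N L V D Λ × ℝ => mulVecL S.AVᵀ z.1.1 - S.vsrc z.2
  fun_prop

theorem obtainedFrom_voltage : ObtainedFrom ∞ (S.coupledDAE F) I 0
    (fun p => S.voltageConstraint (p.1 0, p.2)) :=
  (obtainedFrom_self.clm ((ContinuousLinearMap.fst ℝ _ _).comp ((ContinuousLinearMap.snd ℝ _ _).comp
    (ContinuousLinearMap.snd ℝ _ _)))).congr fun _ _ => rfl

/-- The derivatives `i_L'` as a function of the state. -/
noncomputable def inductorRate (S : Circuit N C R L V J Λ) (z : State N L V D Λ × ℝ) : L → ℝ :=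
  ((fderiv ℝ S.φL (z.1.2.1, z.2)).comp (ContinuousLinearMap.inl ℝ (L → ℝ) ℝ)).inverse
    (S.ALᵀ *ᵥ z.1.1 - fderiv ℝ S.φL (z.1.2.1, z.2) (0, 1))

theorem IsSmooth.fderiv_φL (hS : S.IsSmooth) : ContDiff ℝ ∞ fun z : State N L V D Λ × ℝ =>
    fderiv ℝ S.φL (z.1.2.1, z.2) := by
  have hDφ : ContDiff ℝ ∞ (fderiv ℝ S.φL) := hS.φL.fderiv_right (by simp)
  fun_prop

theorem WellPosed.contDiffAt_inverse_φL (hS : S.WellPosed I) (hsmooth : S.IsSmooth)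
    {z : State N L V D Λ × ℝ} (hz : z.2 ∈ I) :
    ContDiffAt ℝ ∞ (fun z : State N L V D Λ × ℝ => ((fderiv ℝ S.φL (z.1.2.1, z.2)).comp
      (ContinuousLinearMap.inl ℝ (L → ℝ) ℝ)).inverse) z := by
  obtain ⟨e, he⟩ := (hS.posDef_φL hsmooth z.1.2.1 hz).exists_equiv
  have h1 : ContDiffAt ℝ ∞ ContinuousLinearMap.inverse
      ((fderiv ℝ S.φL (z.1.2.1, z.2)).comp (ContinuousLinearMap.inl ℝ (L → ℝ) ℝ)) :=
    he ▸ contDiffAt_map_inverse e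
  exact h1.comp z (hsmooth.fderiv_φL.contDiffAt.clm_comp contDiffAt_const)

theorem WellPosed.smooth_inductorRate (hS : S.WellPosed I) (hsmooth : S.IsSmooth) :
    SmoothAtTimes I (S.inductorRate (D := D)) := fun _ hz =>
  (hS.contDiffAt_inverse_φL hsmooth hz).clm_apply
    (((mulVecL S.ALᵀ).contDiff.comp (contDiff_fst.comp contDiff_fst)).sub
      (hsmooth.fderiv_φL.clm_apply contDiff_const)).contDiffAt

theorem WellPosed.quasilinear_inductor (hS : S.WellPosed I) (hsmooth : S.IsSmooth) :
    ObtainedQuasilinear (S.coupledDAE F) I 0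
    (fun _ => (ContinuousLinearMap.fst ℝ _ _).comp (ContinuousLinearMap.snd ℝ _ _))
    S.inductorRate where
  smooth_coeff _ _ := contDiffAt_const
  smooth_rhs := hS.smooth_inductorRate hsmooth
  obtained := by
    refine ((obtainedFrom_self.clm ((ContinuousLinearMap.fst ℝ _ _).comp
      (ContinuousLinearMap.snd ℝ _ _))).clm_apply (B := fun p => ((fderiv ℝ S.φL
        ((p.1 0).2.1, p.2)).comp (ContinuousLinearMap.inl ℝ (L → ℝ) ℝ)).inverse) fun p hp =>
        ((hS.contDiffAt_inverse_φL hsmooth (z := Jet.baseL p) hp).comp p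
          (Jet.baseL (X := State N L V D Λ) (k := 1)).contDiff.contDiffAt).contDiffWithinAt).congr
      fun p hp => ?_
    obtain ⟨E, hE⟩ := (hS.posDef_φL hsmooth (p.1 0).2.1 hp).exists_equiv
    have h : fderiv ℝ S.φL ((p.1 0).2.1, p.2) ((p.1 1).2.1, 1) =
        E (p.1 1).2.1 + fderiv ℝ S.φL ((p.1 0).2.1, p.2) (0, 1) := by
      have h1 : E (p.1 1).2.1 = fderiv ℝ S.φL ((p.1 0).2.1, p.2) ((p.1 1).2.1, 0) :=
        congrArg (fun A : (L → ℝ) →L[ℝ] (L → ℝ) => A (p.1 1).2.1) hE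
      rw [h1, ← map_add]; simp
    change (p.1 1).2.1 - ContinuousLinearMap.inverse _ (S.ALᵀ *ᵥ (p.1 0).1 -
        fderiv ℝ S.φL ((p.1 0).2.1, p.2) (0, 1)) = ContinuousLinearMap.inverse _
      (fderiv ℝ S.φL ((p.1 0).2.1, p.2) ((p.1 1).2.1, 1) - S.ALᵀ *ᵥ (p.1 0).1)
    rw [h, ← hE, ContinuousLinearMap.inverse_equiv]
    simp
    abel

/-- The arguments `(x, i, v, t)` of the explicit element equations. -/
noncomputable def elementArg (S : Circuit N C R L V J Λ) :
    State N L V D Λ × ℝ →L[ℝ] (D → ℝ) × (Λ → ℝ) × (Λ → ℝ) × ℝ :=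
  (((ContinuousLinearMap.fst ℝ _ _).comp (ContinuousLinearMap.fst ℝ _ _)).comp
      (S.elementVar.comp (ContinuousLinearMap.fst ℝ _ _))).prod
    ((((ContinuousLinearMap.snd ℝ _ _).comp (ContinuousLinearMap.fst ℝ _ _)).comp
      (S.elementVar.comp (ContinuousLinearMap.fst ℝ _ _))).prod
    (((ContinuousLinearMap.snd ℝ _ _).comp (S.elementVar.comp (ContinuousLinearMap.fst ℝ _ _))).prod
      (ContinuousLinearMap.snd ℝ _ _)))

theorem elementArg_apply (z : State N L V D Λ × ℝ) :
    S.elementArg z = (z.1.2.2.2.1, z.1.2.2.2.2, S.AΛᵀ *ᵥ z.1.1, z.2) := rfl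

/-- The explicit equations of the element within the coupled system. -/
theorem quasilinear_element (hsmooth : S.IsSmooth) (hF : IsInductanceLike I F) :
    ∃ (fx : (D → ℝ) × (Λ → ℝ) × (Λ → ℝ) × ℝ → (D → ℝ))
      (fi : (D → ℝ) × (Λ → ℝ) × (Λ → ℝ) × ℝ → (Λ → ℝ)),
      ObtainedQuasilinear (S.coupledDAE F) I 1
        (fun _ => (ContinuousLinearMap.fst ℝ _ _).comp elementEqs) (fun z => fx (S.elementArg z)) ∧
      ObtainedQuasilinear (S.coupledDAE F) I 1
        (fun _ => (ContinuousLinearMap.snd ℝ _ _).comp elementEqs) (fun z => fi (S.elementArg z)) ∧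
      (∀ x i v, ∀ t ∈ I, ContDiffAt ℝ ∞ fi (x, i, v, t)) ∧
      ∀ x i v, ∀ t ∈ I, IsPosDef (fderiv ℝ (fun v' => fi (x, i, v', t)) v) := by
  obtain ⟨fx, fi, hfx, hfi, hRx, hRi, hpos⟩ := hF.exists_explicit
  have hc := hsmooth.coupledDAE hF.1
  have he := IsInductanceLike.contDiff_elementDAE hF.1
  refine ⟨fx, fi, ⟨fun z _ => contDiffAt_const, fun z _ => ?_, ?_⟩,
    ⟨fun z _ => contDiffAt_const, fun z hz => ?_, ?_⟩, hfi, hpos⟩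
  · exact (hfx.comp S.elementArg.contDiff).contDiffAt
  · exact (hRx.map hc he S.elementVar elementEqs elementDAE_elementVar).congr fun p _ => rfl
  · exact (hfi _ _ _ _ hz).comp z (S.elementArg (D := D)).contDiff.contDiffAt
  · exact (hRi.map hc he S.elementVar elementEqs elementDAE_elementVar).congr fun p _ => rfl

/-! ### The equations obtained with one differentiation -/

theorem fderiv_voltageConstraint (hS : S.IsSmooth) (z : State N L V D Λ × ℝ)
    (δ : State N L V D Λ) : fderiv ℝ S.voltageConstraint z (δ, 0) = S.AVᵀ *ᵥ δ.1 := by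
  refine fderiv_eq_of_hasDerivAt_line (hS.voltageConstraint.differentiable (by simp) z) ?_
  have h : (fun s : ℝ => S.voltageConstraint (z + s • (δ, 0))) =
      fun s => S.voltageConstraint z + s • S.AVᵀ *ᵥ δ.1 := by
    ext1 s
    simp [voltageConstraint, Matrix.mulVec_add, Matrix.mulVec_smul]
    abel
  rw [h]
  exact hasDerivAt_add_smul (S.voltageConstraint z) (S.AVᵀ *ᵥ δ.1)

theorem fderiv_nodeCurrent (hS : S.IsSmooth) (z : State N L V D Λ × ℝ) (δ : State N L V D Λ) :
    fderiv ℝ S.nodeCurrent z (δ, 0) =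
      S.AR *ᵥ fderiv ℝ S.g (S.ARᵀ *ᵥ z.1.1, z.2) (S.ARᵀ *ᵥ δ.1, 0)
        + S.AL *ᵥ δ.2.1 + S.AV *ᵥ δ.2.2.1 + S.AΛ *ᵥ δ.2.2.2.2 := by
  refine fderiv_eq_of_hasDerivAt_line (hS.nodeCurrent.differentiable (by simp) z) ?_
  have h : (fun s : ℝ => S.nodeCurrent (z + s • (δ, 0))) =
      fun s => (mulVecL S.AR (S.g ((S.ARᵀ *ᵥ z.1.1, z.2) + s • (S.ARᵀ *ᵥ δ.1, 0))) +
        s • (S.AL *ᵥ δ.2.1 + S.AV *ᵥ δ.2.2.1 + S.AΛ *ᵥ δ.2.2.2.2)) +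
        (S.AL *ᵥ z.1.2.1 + S.AV *ᵥ z.1.2.2.1 + S.AΛ *ᵥ z.1.2.2.2.2 + S.AI *ᵥ S.isrc z.2) := by
    ext1 s
    simp [nodeCurrent, Matrix.mulVec_add, Matrix.mulVec_smul]
    abel
  rw [h]
  have hline := hasDerivAt_add_smul (S.ARᵀ *ᵥ z.1.1, z.2) (S.ARᵀ *ᵥ δ.1, (0 : ℝ))
  have h1 := (mulVecL S.AR).hasFDerivAt.comp_hasDerivAt (0 : ℝ)
    ((hS.g.differentiable (by simp) _).hasFDerivAt.comp_hasDerivAt (0 : ℝ) hline)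
  have h2 := (h1.add ((hasDerivAt_id (0 : ℝ)).smul_const
    (S.AL *ᵥ δ.2.1 + S.AV *ᵥ δ.2.2.1 + S.AΛ *ᵥ δ.2.2.2.2))).add_const
    (S.AL *ᵥ z.1.2.1 + S.AV *ᵥ z.1.2.2.1 + S.AΛ *ᵥ z.1.2.2.2.2 + S.AI *ᵥ S.isrc z.2)
  refine h2.congr_deriv ?_
  simp
  abel

/-- The equations that are obtained with one differentiation: Kirchhoff's current law, the
differentiated voltage constraints, the derivative of Kirchhoff's current law projected along the
capacitors, and the explicit equations for the inductors and for the element. -/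
theorem exists_quasilinear_one (hsmooth : S.IsSmooth) (hI : UniqueDiffOn ℝ I)
    (hS : S.WellPosed I) (hF : IsInductanceLike I F) :
    ∃ (A : State N L V D Λ × ℝ → (State N L V D Λ →L[ℝ]
        (N → ℝ) × (V → ℝ) × (N → ℝ) × (L → ℝ) × (D → ℝ) × (Λ → ℝ))) (b : _),
      ObtainedQuasilinear (S.coupledDAE F) I 1 A b ∧
      ∀ z : State N L V D Λ × ℝ, z.2 ∈ I → ∀ δ, A z δ = 0 →
        S.ACᵀ *ᵥ δ.1 = 0 ∧ S.AVᵀ *ᵥ δ.1 = 0 ∧ S.ARᵀ *ᵥ δ.1 = 0 ∧ δ.2.1 = 0 ∧ δ.2.2.2 = 0 ∧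
          ∀ w, S.ACᵀ *ᵥ w = 0 → w ⬝ᵥ S.AV *ᵥ δ.2.2.1 = 0 := by
  obtain ⟨P, hP⟩ := exists_isKerTransposeProjector S.AC
  obtain ⟨fx, fi, hfx, hfi, -, -⟩ := quasilinear_element hsmooth hF
  have hc := hsmooth.coupledDAE hF.1
  have hnode : ObtainedFrom ∞ (S.coupledDAE F) I 0
      (fun p => P (S.nodeCurrent (p.1 0, p.2))) :=
    ((quasilinear_kcl (F := F) (I := I) hsmooth).obtained.clm P).congr fun p _ => by
      simp [nodalCapacitance_apply, chargeDrift, hP.apply_mulVec]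
  have hPsmooth : ContDiff ℝ ∞ fun z => P (S.nodeCurrent (D := D) z) :=
    P.contDiff.comp hsmooth.nodeCurrent
  have h := ((quasilinear_kcl hsmooth).lift zero_le_one).prod
    ((obtainedFrom_voltage.quasilinear_deriv hc hI
      fun z _ => hsmooth.voltageConstraint.contDiffAt).prod
    ((hnode.quasilinear_deriv (h := fun z => P (S.nodeCurrent z)) hc hI
      fun z _ => hPsmooth.contDiffAt).prod
    (((hS.quasilinear_inductor hsmooth).lift zero_le_one).prod (hfx.prod hfi))))
  refine ⟨_, _, h, fun z hz δ hδ => ?_⟩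
  simp only [Prod.ext_iff, ContinuousLinearMap.prod_apply, Prod.fst_zero, Prod.snd_zero] at hδ
  obtain ⟨h1, h2, h3, h4, h5, h6⟩ := hδ
  have hC : S.ACᵀ *ᵥ δ.1 = 0 :=
    hS.eq_zero_of_capacitance hsmooth hz (e := δ.1) (by
      rw [show S.nodalCapacitance z δ.1 = 0 from h1, dotProduct_zero])
  have hV : S.AVᵀ *ᵥ δ.1 = 0 := (fderiv_voltageConstraint hsmooth z δ).symm.trans h2
  have hL : δ.2.1 = 0 := h4
  have hΛ : δ.2.2.2.2 = 0 := h6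
  have h3' : P (S.AR *ᵥ fderiv ℝ S.g (S.ARᵀ *ᵥ z.1.1, z.2) (S.ARᵀ *ᵥ δ.1, 0)
      + S.AV *ᵥ δ.2.2.1) = 0 := by
    have h7 := (P.hasFDerivAt.comp z
      (hsmooth.nodeCurrent.differentiable (by simp) z).hasFDerivAt).fderiv
    have h8 : P (fderiv ℝ S.nodeCurrent z (δ, 0)) = 0 :=
      (congrArg (fun A : State N L V D Λ × ℝ →L[ℝ] (N → ℝ) => A (δ, 0)) h7).symm.trans h3
    rw [fderiv_nodeCurrent hsmooth, hL, hΛ, Matrix.mulVec_zero, Matrix.mulVec_zero, add_zero,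
      add_zero] at h8
    exact h8
  -- since `e'` lies in `ker A_Cᵀ`, pairing with it removes the projector
  have hR : S.ARᵀ *ᵥ δ.1 = 0 := by
    refine (hS.posDef_g hsmooth (S.ARᵀ *ᵥ z.1.1) hz).eq_zero (le_of_eq ?_)
    have h7 := hP.dotProduct_apply (S.AR *ᵥ fderiv ℝ S.g (S.ARᵀ *ᵥ z.1.1, z.2) (S.ARᵀ *ᵥ δ.1, 0)
      + S.AV *ᵥ δ.2.2.1) δ.1 hC
    rw [h3', dotProduct_zero, dotProduct_add, dotProduct_mulVec_eq_transpose S.AV, hV,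
      zero_dotProduct, add_zero, dotProduct_mulVec_eq_transpose] at h7
    exact h7.symm
  refine ⟨hC, hV, hR, hL, Prod.ext h5 h6, fun w hw => ?_⟩
  rw [← hP.dotProduct_apply _ w hw]
  rw [hR, show ((0 : R → ℝ), (0 : ℝ)) = 0 from rfl, map_zero, Matrix.mulVec_zero, zero_add] at h3'
  rw [h3', dotProduct_zero]

end Circuit

namespace Circuit

variable {N C R L V J Λ D : Type*} {S : Circuit N C R L V J Λ}
  [Fintype N] [Fintype C] [Fintype R] [Fintype L] [Fintype V] [Fintype J] [Fintype Λ] [Fintype D]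
  {F : (D → ℝ) × (Λ → ℝ) × (D → ℝ) × (Λ → ℝ) × (Λ → ℝ) × ℝ → (D → ℝ) × (Λ → ℝ)} {I : Set ℝ}

/-! ### The equations obtained with two differentiations -/

/-- The currents through the cutsets of inductors, current sources and the element satisfy a
constraint. Its derivative is a constraint for the node potentials, and the second derivative
determines `e'` up to the equations obtained with one differentiation. -/
theorem exists_quasilinear_cutset (hsmooth : S.IsSmooth) (hI : UniqueDiffOn ℝ I)
    (hS : S.WellPosed I) (hF : IsInductanceLike I F) :
    ∃ (A : State N L V D Λ × ℝ → (State N L V D Λ →L[ℝ] (N → ℝ))) (b : _),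
      ObtainedQuasilinear (S.coupledDAE F) I 2 A b ∧
      ∀ z : State N L V D Λ × ℝ, z.2 ∈ I → ∀ δ, A z δ = 0 → S.ACᵀ *ᵥ δ.1 = 0 →
        S.AVᵀ *ᵥ δ.1 = 0 → S.ARᵀ *ᵥ δ.1 = 0 → δ.2.1 = 0 → δ.2.2.2 = 0 → δ.1 = 0 := by
  obtain ⟨P, hP⟩ := exists_isKerTransposeProjector
    (Matrix.fromCols S.AR (Matrix.fromCols S.AC S.AV))
  simp only [isKerTransposeProjector_iff, transpose_fromCols_mulVec_eq_zero] at hP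
  obtain ⟨hPmem, -, hPzero, hPdot⟩ := hP
  have hPR : ∀ y, P (S.AR *ᵥ y) = 0 := fun y => by
    simpa [Matrix.fromCols_mulVec_sumElim] using hPzero (Sum.elim y 0)
  have hPC : ∀ y, P (S.AC *ᵥ y) = 0 := fun y => by
    simpa [Matrix.fromCols_mulVec_sumElim] using hPzero (Sum.elim 0 (Sum.elim y 0))
  have hPV : ∀ y, P (S.AV *ᵥ y) = 0 := fun y => by
    simpa [Matrix.fromCols_mulVec_sumElim] using hPzero (Sum.elim 0 (Sum.elim 0 y))
  obtain ⟨fx, fi, -, hfi, hfi_smooth, hpos⟩ := quasilinear_element hsmooth hF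
  have hc := hsmooth.coupledDAE hF.1
  have hJ := hsmooth.isrc
  have hJ' : ContDiff ℝ ∞ (deriv S.isrc) := (contDiff_infty_iff_deriv.1 hJ).2
  -- the constraint for the currents
  let h₀ : State N L V D Λ × ℝ → (N → ℝ) := fun z =>
    P (mulVecL S.AL z.1.2.1 + mulVecL S.AΛ z.1.2.2.2.2 + mulVecL S.AI (S.isrc z.2))
  have hh₀ : ContDiff ℝ ∞ h₀ := by fun_prop
  have H₀ : ObtainedFrom ∞ (S.coupledDAE F) I 0 (fun p => h₀ (p.1 0, p.2)) :=
    ((quasilinear_kcl (F := F) (I := I) hsmooth).obtained.clm P).congr fun p _ => by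
      simp [nodalCapacitance_apply, chargeDrift, nodeCurrent, hPR, hPC, hPV, h₀]
  have hh₀' : ∀ (z : State N L V D Λ × ℝ) (x : State N L V D Λ), fderiv ℝ h₀ z (x, 1) =
      P (S.AL *ᵥ x.2.1 + S.AΛ *ᵥ x.2.2.2.2 + S.AI *ᵥ deriv S.isrc z.2) := by
    intro z x
    refine fderiv_eq_of_hasDerivAt_line (hh₀.differentiable (by simp) z) ?_
    have h : (fun s : ℝ => h₀ (z + s • (x, (1 : ℝ)))) = fun s =>
        P ((s • (S.AL *ᵥ x.2.1 + S.AΛ *ᵥ x.2.2.2.2) + mulVecL S.AI (S.isrc (z.2 + s)))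
          + (S.AL *ᵥ z.1.2.1 + S.AΛ *ᵥ z.1.2.2.2.2)) := by
      ext1 s
      refine congrArg P ?_
      simp [Matrix.mulVec_add, Matrix.mulVec_smul]
      abel
    rw [h]
    have h1 : HasDerivAt (fun s : ℝ => S.isrc (z.2 + s)) (deriv S.isrc z.2) 0 := by
      have h2 := (hJ.differentiable (by simp) (z.2 + 0)).hasDerivAt.comp_const_add z.2 0
      simpa using h2
    have h3 := P.hasFDerivAt.comp_hasDerivAt (0 : ℝ)
      ((((hasDerivAt_id (0 : ℝ)).smul_const (S.AL *ᵥ x.2.1 + S.AΛ *ᵥ x.2.2.2.2)).add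
        ((mulVecL S.AI).hasFDerivAt.comp_hasDerivAt (0 : ℝ) h1)).add_const
          (S.AL *ᵥ z.1.2.1 + S.AΛ *ᵥ z.1.2.2.2.2))
    refine h3.congr_deriv ?_
    simp
  -- its derivative, after the insertion of the rates of the currents
  let h₁ : State N L V D Λ × ℝ → (N → ℝ) := fun z =>
    P (mulVecL S.AL (S.inductorRate z) + mulVecL S.AΛ (fi (S.elementArg z))
      + mulVecL S.AI (deriv S.isrc z.2))
  have hh₁ : SmoothAtTimes I h₁ := fun z hz =>
    P.contDiff.contDiffAt.comp z ((((mulVecL S.AL).contDiff.contDiffAt.comp z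
      (hS.smooth_inductorRate hsmooth z hz)).add
      ((mulVecL S.AΛ).contDiff.contDiffAt.comp z (hfi.smooth_rhs z hz))).add
      ((mulVecL S.AI).contDiff.comp (hJ'.comp contDiff_snd)).contDiffAt)
  have H₁ : ObtainedFrom ∞ (S.coupledDAE F) I 1 (fun p => h₁ (p.1 0, p.2)) := by
    refine (((H₀.deriv_along hc hI fun z _ => hh₀.contDiffAt).sub
      (((hS.quasilinear_inductor hsmooth).lift zero_le_one).obtained.clm
        (P.comp (mulVecL S.AL)))).sub (hfi.obtained.clm (P.comp (mulVecL S.AΛ)))).congr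
      fun p _ => ?_
    rw [hh₀' (p.1 0, p.2) (p.1 1)]
    change P (S.AL *ᵥ _ + S.AΛ *ᵥ _ + S.AI *ᵥ _) = P _ - P (S.AL *ᵥ ((p.1 1).2.1 - _))
      - P (S.AΛ *ᵥ ((p.1 1).2.2.2.2 - _))
    rw [← map_sub, ← map_sub, Matrix.mulVec_sub, Matrix.mulVec_sub]
    congr 1
    abel
  refine ⟨_, _, H₁.quasilinear_deriv hc hI hh₁, fun z hz δ hδ hC hV hR hL hΛ => ?_⟩
  obtain ⟨w, a, i, y⟩ := δ
  obtain rfl : a = 0 := hL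
  obtain rfl : y = 0 := hΛ
  -- the derivative of the constraint in the direction of `w`
  let Jinv := ((fderiv ℝ S.φL (z.1.2.1, z.2)).comp
    (ContinuousLinearMap.inl ℝ (L → ℝ) ℝ)).inverse
  let Fv := fderiv ℝ (fun v' => fi (z.1.2.2.2.1, z.1.2.2.2.2, v', z.2)) (S.AΛᵀ *ᵥ z.1.1)
  have hderiv : fderiv ℝ h₁ z ((w, 0, i, 0), 0) =
      P (S.AL *ᵥ Jinv (S.ALᵀ *ᵥ w) + S.AΛ *ᵥ Fv (S.AΛᵀ *ᵥ w)) := by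
    refine fderiv_eq_of_hasDerivAt_line ((hh₁ z hz).differentiableAt (by simp)) ?_
    have h : (fun s : ℝ => h₁ (z + s • ((w, 0, i, 0), 0))) = fun s =>
        P ((s • S.AL *ᵥ Jinv (S.ALᵀ *ᵥ w) + mulVecL S.AΛ
            (fi (z.1.2.2.2.1, z.1.2.2.2.2, S.AΛᵀ *ᵥ z.1.1 + s • S.AΛᵀ *ᵥ w, z.2)))
          + (S.AL *ᵥ S.inductorRate z + S.AI *ᵥ deriv S.isrc z.2)) := by
      ext1 s
      refine congrArg P ?_
      have h2 : S.inductorRate (z + s • (((w, 0, i, 0) : State N L V D Λ), (0 : ℝ))) =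
          S.inductorRate z + s • Jinv (S.ALᵀ *ᵥ w) := by
        have h4 : (z + s • (((w, 0, i, 0) : State N L V D Λ), (0 : ℝ))).1.2.1 = z.1.2.1 := by simp
        have h5 : (z + s • (((w, 0, i, 0) : State N L V D Λ), (0 : ℝ))).2 = z.2 := by simp
        have h6 : S.ALᵀ *ᵥ (z + s • (((w, 0, i, 0) : State N L V D Λ), (0 : ℝ))).1.1 =
            S.ALᵀ *ᵥ z.1.1 + s • S.ALᵀ *ᵥ w := by simp [Matrix.mulVec_add, Matrix.mulVec_smul]
        unfold inductorRate
        rw [h4, h5, h6, add_sub_right_comm, map_add, map_smul]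
      have h3 : S.elementArg (z + s • (((w, 0, i, 0) : State N L V D Λ), (0 : ℝ))) =
          (z.1.2.2.2.1, z.1.2.2.2.2, S.AΛᵀ *ᵥ z.1.1 + s • S.AΛᵀ *ᵥ w, z.2) := by
        simp [elementArg_apply, Matrix.mulVec_add, Matrix.mulVec_smul]
      rw [h2, h3]
      simp [Matrix.mulVec_add, Matrix.mulVec_smul]
      abel
    rw [h]
    have hline := hasDerivAt_add_smul (S.AΛᵀ *ᵥ z.1.1) (S.AΛᵀ *ᵥ w)
    have hFv : HasFDerivAt (fun v' => fi (z.1.2.2.2.1, z.1.2.2.2.2, v', z.2)) Fv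
        (S.AΛᵀ *ᵥ z.1.1 + (0 : ℝ) • S.AΛᵀ *ᵥ w) := by
      rw [zero_smul, add_zero]
      refine DifferentiableAt.hasFDerivAt ?_
      exact ((hfi_smooth _ _ (S.AΛᵀ *ᵥ z.1.1) _ hz).differentiableAt (by simp)).comp
        (f := fun v' : Λ → ℝ => (z.1.2.2.2.1, z.1.2.2.2.2, v', z.2)) _ (by fun_prop)
    have h3 := P.hasFDerivAt.comp_hasDerivAt (0 : ℝ)
      ((((hasDerivAt_id (0 : ℝ)).smul_const (S.AL *ᵥ Jinv (S.ALᵀ *ᵥ w))).add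
        ((mulVecL S.AΛ).hasFDerivAt.comp_hasDerivAt (0 : ℝ)
          (hFv.comp_hasDerivAt (0 : ℝ) hline))).add_const
          (S.AL *ᵥ S.inductorRate z + S.AI *ᵥ deriv S.isrc z.2))
    refine h3.congr_deriv ?_
    simp
  have h1 : P (S.AL *ᵥ Jinv (S.ALᵀ *ᵥ w) + S.AΛ *ᵥ Fv (S.AΛᵀ *ᵥ w)) = 0 := hderiv.symm.trans hδ
  have h2 := hPdot (S.AL *ᵥ Jinv (S.ALᵀ *ᵥ w) + S.AΛ *ᵥ Fv (S.AΛᵀ *ᵥ w)) w ⟨hR, hC, hV⟩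
  rw [h1, dotProduct_zero, dotProduct_add, dotProduct_mulVec_eq_transpose,
    dotProduct_mulVec_eq_transpose] at h2
  have hJpos : IsPosDef Jinv := (hS.posDef_φL hsmooth z.1.2.1 hz).inverse
  have hFpos : IsPosDef Fv := hpos _ _ _ _ hz
  have hL0 := hJpos.nonneg (S.ALᵀ *ᵥ w)
  have hΛ0 := hFpos.nonneg (S.AΛᵀ *ᵥ w)
  exact hS.eq_zero hR hC hV (hJpos.eq_zero (by linarith)) (hFpos.eq_zero (by linarith))

/-- The voltages across the voltage sources are prescribed; inserting Kirchhoff's current law into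
their derivative expresses `i_V` by the remaining variables. Differentiating once more determines
`i_V'`. -/
theorem exists_quasilinear_loop (hsmooth : S.IsSmooth) (hI : UniqueDiffOn ℝ I)
    (hS : S.WellPosed I) (hF : IsInductanceLike I F) :
    ∃ (A : State N L V D Λ × ℝ → (State N L V D Λ →L[ℝ] (V → ℝ))) (b : _),
      ObtainedQuasilinear (S.coupledDAE F) I 2 A b ∧
      ∀ z : State N L V D Λ × ℝ, z.2 ∈ I → ∀ δ, A z δ = 0 → δ.1 = 0 → δ.2.1 = 0 → δ.2.2.2 = 0 →
        δ.2.2.1 = 0 := by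
  obtain ⟨P, hP⟩ := exists_isKerTransposeProjector (Matrix.fromCols S.AC S.AV)
  simp only [isKerTransposeProjector_iff, transpose_fromCols_mulVec_eq_zero] at hP
  obtain ⟨hPmem, hPself, -, hPdot⟩ := hP
  have hc := hsmooth.coupledDAE hF.1
  -- the equations for `(e', i_V)`, made injective by the component of `e'` in `ker (A_C A_V)ᵀ`
  let H : State N L V D Λ × ℝ → ((N → ℝ) × (V → ℝ) →L[ℝ] (N → ℝ) × (V → ℝ) × (N → ℝ)) := fun z =>
    (ContinuousLinearMap.inl ℝ (N → ℝ) ((V → ℝ) × (N → ℝ))).comp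
        ((S.nodalCapacitance z).comp (ContinuousLinearMap.fst ℝ _ _)) +
      (((mulVecL S.AV).comp (ContinuousLinearMap.snd ℝ _ _)).prod
        (((mulVecL S.AVᵀ).comp (ContinuousLinearMap.fst ℝ _ _)).prod
          (P.comp (ContinuousLinearMap.fst ℝ _ _))))
  have hH : ∀ z e i, H z (e, i) = (S.nodalCapacitance z e + S.AV *ᵥ i, S.AVᵀ *ᵥ e, P e) := by
    intro z e i
    simp [H]
  have hHsmooth : ContDiff ℝ ∞ H :=
    (contDiff_const.clm_comp (hsmooth.nodalCapacitance.clm_comp contDiff_const)).add contDiff_const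
  have hHinj : ∀ z : State N L V D Λ × ℝ, z.2 ∈ I → Function.Injective (H z) := by
    intro z hz
    rw [injective_iff_map_eq_zero]
    rintro ⟨e, i⟩ h
    rw [hH, Prod.mk_eq_zero, Prod.mk_eq_zero] at h
    obtain ⟨h1, h2, h3⟩ := h
    have hC : S.ACᵀ *ᵥ e = 0 := by
      refine hS.eq_zero_of_capacitance hsmooth hz (le_of_eq ?_)
      have h4 : e ⬝ᵥ (S.nodalCapacitance z e + S.AV *ᵥ i) = 0 := by rw [h1, dotProduct_zero]
      rwa [dotProduct_add, dotProduct_mulVec_eq_transpose S.AV, h2, zero_dotProduct,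
        add_zero] at h4
    have he : e = 0 := (hPself e ⟨hC, h2⟩).symm.trans h3
    rw [he, map_zero, zero_add] at h1
    have hi : i = 0 := by
      have h5 := hS.noVLoop
      rw [LinearMap.ker_eq_bot'] at h5
      exact h5 i h1
    rw [he, hi, Prod.mk_zero_zero]
  obtain ⟨G, hG⟩ := exists_contDiffAt_leftInverse ((N → ℝ) × (V → ℝ))
    ((N → ℝ) × (V → ℝ) × (N → ℝ))
  -- the part of the left inverse that recovers `i_V`
  let T : State N L V D Λ × ℝ → ((N → ℝ) × (V → ℝ) →L[ℝ] (V → ℝ)) := fun z =>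
    (ContinuousLinearMap.snd ℝ (N → ℝ) (V → ℝ)).comp ((G (H z)).comp
      ((ContinuousLinearMap.fst ℝ _ _).prod ((ContinuousLinearMap.snd ℝ _ _).prod 0)))
  have hT : ∀ z : State N L V D Λ × ℝ, z.2 ∈ I → ∀ e i,
      T z (S.nodalCapacitance z e + S.AV *ᵥ i, S.AVᵀ *ᵥ e) = i := by
    intro z hz e i
    have h1 : H z (e - P e, i) = (S.nodalCapacitance z e + S.AV *ᵥ i, S.AVᵀ *ᵥ e, 0) := by
      have h2 : S.nodalCapacitance z (P e) = 0 := by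
        rw [nodalCapacitance_apply, (hPmem e).1, map_zero, Matrix.mulVec_zero]
      rw [hH, map_sub, map_sub, h2, sub_zero, hPself _ (hPmem e), sub_self, Matrix.mulVec_sub,
        (hPmem e).2, sub_zero]
    have h2 : T z (S.nodalCapacitance z e + S.AV *ᵥ i, S.AVᵀ *ᵥ e) =
        (G (H z) (H z (e - P e, i))).2 := by rw [h1]; rfl
    rw [h2, (hG _ (hHinj z hz)).2]
  have hTsmooth : SmoothAtTimes I T := fun z hz =>
    contDiffAt_const.clm_comp ((((hG _ (hHinj z hz)).1).comp z hHsmooth.contDiffAt).clm_comp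
      contDiffAt_const)
  -- the remaining terms; they do not contain `i_V`
  let c : State N L V D Λ × ℝ → (N → ℝ) × (V → ℝ) := fun z =>
    (-(S.chargeDrift z + (S.nodeCurrent z - mulVecL S.AV z.1.2.2.1)), deriv S.vsrc z.2)
  have hc_smooth : ContDiff ℝ ∞ c := by
    have h1 := hsmooth.chargeDrift (D := D)
    have h2 := hsmooth.nodeCurrent (D := D)
    have h3 : ContDiff ℝ ∞ (deriv S.vsrc) := (contDiff_infty_iff_deriv.1 hsmooth.vsrc).2
    fun_prop
  let ψ : State N L V D Λ × ℝ → (V → ℝ) := fun z => z.1.2.2.1 - T z (c z)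
  have hψ : SmoothAtTimes I ψ := fun z hz =>
    ContDiffAt.sub (ContDiff.contDiffAt (by fun_prop))
      ((hTsmooth z hz).clm_apply hc_smooth.contDiffAt)
  have hvolt : ∀ (z : State N L V D Λ × ℝ) (x : State N L V D Λ),
      fderiv ℝ S.voltageConstraint z (x, 1) = S.AVᵀ *ᵥ x.1 - deriv S.vsrc z.2 := by
    intro z x
    refine fderiv_eq_of_hasDerivAt_line (hsmooth.voltageConstraint.differentiable (by simp) z) ?_
    have h : (fun s : ℝ => S.voltageConstraint (z + s • (x, (1 : ℝ)))) = fun s =>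
        (S.AVᵀ *ᵥ z.1.1 + s • S.AVᵀ *ᵥ x.1) - S.vsrc (z.2 + s) := by
      ext1 s
      simp [voltageConstraint, Matrix.mulVec_add, Matrix.mulVec_smul]
    rw [h]
    have h1 : HasDerivAt (fun s : ℝ => S.vsrc (z.2 + s)) (deriv S.vsrc z.2) 0 := by
      have h2 := (hsmooth.vsrc.differentiable (by simp) (z.2 + 0)).hasDerivAt.comp_const_add z.2 0
      simpa using h2
    exact (hasDerivAt_add_smul (S.AVᵀ *ᵥ z.1.1) (S.AVᵀ *ᵥ x.1)).fun_sub h1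
  have Hψ : ObtainedFrom ∞ (S.coupledDAE F) I 1 (fun p => ψ (p.1 0, p.2)) := by
    have h1 := ((quasilinear_kcl hsmooth).lift zero_le_one).obtained.prodMk
      (obtainedFrom_voltage.deriv_along (F := S.coupledDAE F) (I := I) hc hI
        fun z _ => hsmooth.voltageConstraint.contDiffAt)
    refine (h1.clm_apply (B := fun p => T (p.1 0, p.2)) fun p hp =>
      ((hTsmooth (Jet.baseL p) hp).comp p
        (Jet.baseL (X := State N L V D Λ) (k := 2)).contDiff.contDiffAt).contDiffWithinAt).congr
      fun p hp => ?_
    have h2 := hT (p.1 0, p.2) hp (p.1 1).1 (p.1 0).2.2.1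
    change (p.1 0).2.2.1 - T (p.1 0, p.2) (c (p.1 0, p.2)) = _
    nth_rewrite 1 [← h2]
    rw [← map_sub, hvolt (p.1 0, p.2) (p.1 1)]
    refine congrArg (T (p.1 0, p.2)) (Prod.ext ?_ rfl)
    simp [c]
    abel
  refine ⟨_, _, Hψ.quasilinear_deriv hc hI hψ, fun z hz δ hδ he hL hΛ => ?_⟩
  obtain ⟨w, a, i, y⟩ := δ
  obtain rfl : w = 0 := he
  obtain rfl : a = 0 := hL
  obtain rfl : y = 0 := hΛ
  have hderiv : fderiv ℝ ψ z ((0, 0, i, 0), 0) = i := by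
    refine fderiv_eq_of_hasDerivAt_line ((hψ z hz).differentiableAt (by simp)) ?_
    have h : (fun s : ℝ => ψ (z + s • (((0, 0, i, 0) : State N L V D Λ), (0 : ℝ)))) = fun s =>
        z.1.2.2.1 + s • i - T z (c z) := by
      ext1 s
      have h1 : c (z + s • (((0, 0, i, 0) : State N L V D Λ), (0 : ℝ))) = c z := by
        simp [c, chargeDrift, nodeCurrent, Matrix.mulVec_add]
        abel
      have h2 : T (z + s • (((0, 0, i, 0) : State N L V D Λ), (0 : ℝ))) = T z := by
        simp [T, H, nodalCapacitance, capacitance]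
      simp only [ψ, h1, h2]
      simp
    rw [h]
    exact (hasDerivAt_add_smul z.1.2.2.1 i).sub_const (T z (c z))
  exact hderiv.symm.trans hδ

end Circuit

namespace Circuit

variable {N C R L V J Λ D : Type*} {S : Circuit N C R L V J Λ}
  [Fintype N] [Fintype C] [Fintype R] [Fintype L] [Fintype V] [Fintype J] [Fintype Λ] [Fintype D]
  {F : (D → ℝ) × (Λ → ℝ) × (D → ℝ) × (Λ → ℝ) × (Λ → ℝ) × ℝ → (D → ℝ) × (Λ → ℝ)} {I : Set ℝ}

/-! ### The reductions to an ordinary differential equation -/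

theorem reducibleToODE_one (hsmooth : S.IsSmooth) (hI : UniqueDiffOn ℝ I)
    (hS : S.WellPosed I) (hF : IsInductanceLike I F) (hcut : S.NoLIΛCutset)
    (hloop : ∀ i, (∀ w, S.ACᵀ *ᵥ w = 0 → w ⬝ᵥ S.AV *ᵥ i = 0) → i = 0) :
    ReducibleToODE (S.coupledDAE F) I 1 := by
  obtain ⟨A, b, hA, hker⟩ := exists_quasilinear_one hsmooth hI hS hF
  refine hA.reducibleToODE fun z hz => ?_
  rw [injective_iff_map_eq_zero]
  rintro ⟨e, a, i, y⟩ hδ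
  obtain ⟨hC, hV, hR, rfl, rfl, hi⟩ := hker z hz _ hδ
  obtain rfl : e = 0 := noLIΛCutset_iff.1 hcut e hR hC hV
  obtain rfl : i = 0 := hloop i hi
  rfl

/-- With two differentiations, `e'` is determined first, and `i_V'` afterwards. -/
theorem reducibleToODE_two (hsmooth : S.IsSmooth) (hI : UniqueDiffOn ℝ I)
    (hS : S.WellPosed I) (hF : IsInductanceLike I F) :
    ReducibleToODE (S.coupledDAE F) I 2 := by
  obtain ⟨A, b, hA, hker⟩ := exists_quasilinear_one hsmooth hI hS hF
  obtain ⟨A', b', hA', hker'⟩ := exists_quasilinear_cutset hsmooth hI hS hF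
  obtain ⟨A'', b'', hA'', hker''⟩ := exists_quasilinear_loop hsmooth hI hS hF
  refine ((hA.lift one_le_two).prod (hA'.prod hA'')).reducibleToODE fun z hz => ?_
  rw [injective_iff_map_eq_zero]
  rintro ⟨e, a, i, y⟩ hδ
  simp only [ContinuousLinearMap.prod_apply, Prod.mk_eq_zero] at hδ
  obtain ⟨h, h', h''⟩ := hδ
  obtain ⟨hC, hV, hR, rfl, rfl, -⟩ := hker z hz _ h
  obtain rfl : e = 0 := hker' z hz _ h' hC hV hR rfl rfl
  obtain rfl : i = 0 := hker'' z hz _ h'' rfl rfl rfl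
  rfl

/-! ### Cutsets and loops prevent a reduction with one differentiation -/

theorem fderiv_coupledDAE_eq_zero (hc : ContDiff ℝ ∞ (S.coupledDAE F))
    {x₁ x δ₂ δ₁ : State N L V D Λ} {t : ℝ}
    (h : HasDerivAt (fun s : ℝ => S.coupledDAE F (x₁ + s • δ₂, x + s • δ₁, t)) 0 0) :
    fderiv ℝ (S.coupledDAE F) (x₁, x, t) (δ₂, δ₁, 0) = 0 := by
  refine fderiv_eq_of_hasDerivAt_line (hc.differentiable (by simp) _) ?_
  simpa using h

/-- The system contains `e'` only in the form `A_Cᵀ e'`, and it does not contain `i_V'`. -/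
theorem coupledDAE_add_eq {w : N → ℝ} (hw : S.ACᵀ *ᵥ w = 0) (i : V → ℝ)
    (x₁ x : State N L V D Λ) (t : ℝ) :
    S.coupledDAE F (x₁ + (w, 0, i, 0), x, t) = S.coupledDAE F (x₁, x, t) := by
  simp [coupledDAE, Matrix.mulVec_add, hw]

/-- A loop of capacitors and voltage sources: a change of `i_V'` along the loop is compensated by
capacitor currents, that is by a change of `e''`. -/
theorem not_reducibleToODE_one_of_loop (hsmooth : S.IsSmooth) (hS : S.WellPosed I)
    (hF : IsInductanceLike I F) (hcons : IsConsistent (S.coupledDAE F) I 1) {i : V → ℝ}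
    (hi : i ≠ 0) (hloop : ∀ w, S.ACᵀ *ᵥ w = 0 → w ⬝ᵥ S.AV *ᵥ i = 0) :
    ¬ ReducibleToODE (S.coupledDAE F) I 1 := by
  obtain ⟨p, hp, hp0⟩ := hcons
  have hc := hsmooth.coupledDAE hF.1
  -- the change of `e''`
  obtain ⟨d, hd⟩ := exists_mulVec_posDef_eq
    (hS.posDef_q hsmooth (S.ACᵀ *ᵥ (p.1 0).1) hp) (y := -(S.AV *ᵥ i))
    fun w hw => by rw [dotProduct_neg, hloop w hw, neg_zero]
  refine not_reducibleToODE_one hc hp (hp0 0) (hp0 1) (δ₁ := (0, 0, i, 0)) (δ₂ := (d, 0, 0, 0))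
    (fun h => hi (congrArg (fun x : State N L V D Λ => x.2.2.1) h))
    (coupledDAE_add_eq (Matrix.mulVec_zero _) i) (fderiv_coupledDAE_eq_zero hc ?_)
  have hconst : ∀ s : ℝ, S.coupledDAE F (p.1 1 + s • ((d, 0, 0, 0) : State N L V D Λ),
      p.1 0 + s • ((0, 0, i, 0) : State N L V D Λ), p.2) = S.coupledDAE F (p.1 1, p.1 0, p.2) := by
    intro s
    have h1 : fderiv ℝ S.q (S.ACᵀ *ᵥ (p.1 0).1, p.2) (S.ACᵀ *ᵥ (p.1 1).1 + s • S.ACᵀ *ᵥ d, 1) =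
        fderiv ℝ S.q (S.ACᵀ *ᵥ (p.1 0).1, p.2) (S.ACᵀ *ᵥ (p.1 1).1, 1) +
        s • fderiv ℝ S.q (S.ACᵀ *ᵥ (p.1 0).1, p.2) (S.ACᵀ *ᵥ d, 0) := by
      rw [← map_smul, ← map_add]; simp
    have h2 : S.AC *ᵥ fderiv ℝ S.q (S.ACᵀ *ᵥ (p.1 0).1, p.2) (S.ACᵀ *ᵥ d, 0) =
      -(S.AV *ᵥ i) := hd
    simp [coupledDAE, Matrix.mulVec_add, Matrix.mulVec_smul, h1, h2]
    abel
  simp only [hconst]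
  exact hasDerivAt_const _ _

/-- A cutset of inductors, current sources and the element: a change of `e'` along the cutset is
compensated by changes of the second derivatives of the variables of the inductors and of the
element. -/
theorem not_reducibleToODE_one_of_cutset (hsmooth : S.IsSmooth) (hS : S.WellPosed I)
    (hF : IsInductanceLike I F) (hcons : IsConsistent (S.coupledDAE F) I 1) {w : N → ℝ}
    (hw : w ≠ 0) (hR : S.ARᵀ *ᵥ w = 0) (hC : S.ACᵀ *ᵥ w = 0) (hV : S.AVᵀ *ᵥ w = 0) :
    ¬ ReducibleToODE (S.coupledDAE F) I 1 := by
  obtain ⟨p, hp, hp0⟩ := hcons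
  have hc := hsmooth.coupledDAE hF.1
  have he := IsInductanceLike.contDiff_elementDAE hF.1
  have hnat := derivArray_mapL hc he S.elementVar elementEqs elementDAE_elementVar
  have hq0 : derivArray (elementDAE F) 0
      ((Jet.mapL S.elementVar p : Jet 2 _).trunc (Nat.le_succ 1)) = 0 :=
    (hnat 0 (p.trunc (Nat.le_succ 1))).trans ((congrArg elementEqs (hp0 0)).trans (map_zero _))
  have hq1 : derivArray (elementDAE F) 1 (Jet.mapL S.elementVar p) = 0 :=
    (hnat 1 p).trans ((congrArg elementEqs (hp0 1)).trans (map_zero _))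
  -- the change of the second derivatives of the element variables
  obtain ⟨y, hy⟩ := hF.exists_compensation hp hq0 hq1 (S.AΛᵀ *ᵥ w)
  -- the change of `i_L''`
  obtain ⟨d, hd⟩ : ∃ d, fderiv ℝ S.φL ((p.1 0).2.1, p.2) (d, 0) = S.ALᵀ *ᵥ w := by
    obtain ⟨E, hE⟩ := (hS.posDef_φL hsmooth (p.1 0).2.1 hp).exists_equiv
    exact ⟨E.symm (S.ALᵀ *ᵥ w), (congrArg (fun A : (L → ℝ) →L[ℝ] (L → ℝ) =>
      A (E.symm (S.ALᵀ *ᵥ w))) hE).symm.trans (E.apply_symm_apply _)⟩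
  refine not_reducibleToODE_one hc hp (hp0 0) (hp0 1) (δ₁ := (w, 0, 0, 0)) (δ₂ := (0, d, 0, y))
    (fun h => hw (congrArg (fun x : State N L V D Λ => x.1) h))
    (coupledDAE_add_eq hC 0) (fderiv_coupledDAE_eq_zero hc ?_)
  let x₁ : ℝ → State N L V D Λ := fun s => p.1 1 + s • ((0, d, 0, y) : State N L V D Λ)
  let x : ℝ → State N L V D Λ := fun s => p.1 0 + s • ((w, 0, 0, 0) : State N L V D Λ)
  have h1 : ∀ s : ℝ, S.coupledDAE F (x₁ s, x s, p.2) =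
      ((S.coupledDAE F (p.1 1, p.1 0, p.2)).1, (S.coupledDAE F (p.1 1, p.1 0, p.2)).2.1,
        (S.coupledDAE F (p.1 1, p.1 0, p.2)).2.2.1,
        elementDAE F (S.elementVar (x₁ s), S.elementVar (x s), p.2)) := by
    intro s
    have h2 : fderiv ℝ S.φL ((p.1 0).2.1, p.2) ((p.1 1).2.1 + s • d, 1) =
        fderiv ℝ S.φL ((p.1 0).2.1, p.2) ((p.1 1).2.1, 1) + s • S.ALᵀ *ᵥ w := by
      rw [← hd, ← map_smul, ← map_add]; simp
    simp [coupledDAE, elementDAE, x₁, x, Matrix.mulVec_add, Matrix.mulVec_smul, hR, hC, hV, h2]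
  have hline : HasDerivAt (fun s : ℝ => (S.elementVar (x₁ s), S.elementVar (x s), p.2))
      ((y, 0), (0, S.AΛᵀ *ᵥ w), 0) 0 := by
    have h4 := (S.elementVar.hasFDerivAt.comp_hasDerivAt (0 : ℝ)
      (hasDerivAt_add_smul (p.1 1) (0, d, 0, y))).prodMk
      ((S.elementVar.hasFDerivAt.comp_hasDerivAt (0 : ℝ)
        (hasDerivAt_add_smul (p.1 0) (w, 0, 0, 0))).prodMk (hasDerivAt_const (0 : ℝ) p.2))
    refine h4.congr_deriv ?_
    simp
  have hx : (S.elementVar (x₁ 0), S.elementVar (x 0), p.2) =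
      ((Jet.mapL S.elementVar p).1 1, (Jet.mapL S.elementVar p).1 0, p.2) := by
    simp [x₁, x]
  have hG := ((he.differentiable (by simp) _).hasFDerivAt).comp_hasDerivAt (0 : ℝ) hline
  rw [hx] at hG
  replace hG := hG.congr_deriv hy
  change HasDerivAt (fun s => S.coupledDAE F (x₁ s, x s, p.2)) 0 0
  simp only [h1]
  exact (hasDerivAt_const _ _).prodMk ((hasDerivAt_const _ _).prodMk
    ((hasDerivAt_const _ _).prodMk hG))

end Circuit

theorem mainTheorem1 {N C R L V J Λ D : Type*} [Fintype N] [Fintype C] [Fintype R] [Fintype L]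
    [Fintype V] [Fintype J] [Fintype Λ] [Fintype D]
    (t₀ t₁ : ℝ) (ht : t₀ < t₁)
    (S : Circuit N C R L V J Λ) (hsmooth : S.IsSmooth) (hS : S.WellPosed (Set.Icc t₀ t₁))
    (F : (D → ℝ) × (Λ → ℝ) × (D → ℝ) × (Λ → ℝ) × (Λ → ℝ) × ℝ → (D → ℝ) × (Λ → ℝ))
    (hF : IsInductanceLike (Set.Icc t₀ t₁) F)
    (hDAE : IsDAE (S.coupledDAE F) (Set.Icc t₀ t₁))
    (hcons : IsConsistent (S.coupledDAE F) (Set.Icc t₀ t₁) 1)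
    (QC : Matrix N N ℝ) (hQC : S.IsProjectorQC QC) :
    (S.NoLIΛCutset ∧ S.NoCVLoop QC →
      HasDifferentialIndex (S.coupledDAE F) (Set.Icc t₀ t₁) 1) ∧
    (¬ (S.NoLIΛCutset ∧ S.NoCVLoop QC) →
      HasDifferentialIndex (S.coupledDAE F) (Set.Icc t₀ t₁) 2) := by
  have hI : UniqueDiffOn ℝ (Set.Icc t₀ t₁) := uniqueDiffOn_Icc ht
  have h0 : ¬ ReducibleToODE (S.coupledDAE F) (Set.Icc t₀ t₁) 0 :=
    not_reducibleToODE_zero (hsmooth.coupledDAE hF.1) hDAE hcons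
  rw [Circuit.noCVLoop_iff hQC]
  constructor
  · rintro ⟨hcut, hloop⟩
    refine ⟨Circuit.reducibleToODE_one hsmooth hI hS hF hcut hloop, fun k hk => ?_⟩
    obtain rfl : k = 0 := by omega
    exact h0
  · intro h
    refine ⟨Circuit.reducibleToODE_two hsmooth hI hS hF, fun k hk => ?_⟩
    obtain rfl | rfl : k = 0 ∨ k = 1 := by omega
    · exact h0
    · rw [Circuit.noLIΛCutset_iff, not_and_or] at h
      push Not at h
      rcases h with ⟨w, hR, hC, hV, hw⟩ | ⟨i, hloop, hi⟩
      · exact Circuit.not_reducibleToODE_one_of_cutset hsmooth hS hF hcons hw hR hC hV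
      · exact Circuit.not_reducibleToODE_one_of_loop hsmooth hS hF hcons hi hloop
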